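/- Let $X$ be a Banach space, $T>0$, $J=[0,T]$, $1<\alpha\le 2$ and $q=\alpha/2$. Let $\psi\in C^1(J)$ be strictly increasing with $\psi'(t)\neq 0$ for all $t\in J$. Let $A$ be the infinitesimal generator of a strongly continuous cosine family $(C(t))_{t\in\mathbb R}$ of bounded linear operators on $X$ (that is, $C(0)=I$, $C(t+s)+C(t-s)=2C(t)C(s)$ for all $s,t\in\mathbb R$, $t\mapsto C(t)x$ is continuous for every $x\in X$, and $Ax=\frac{d^2}{dt^2}C(t)x\big|_{t=0}$ on the set $\mathcal D(A)$ of all $x$ with $C(\cdot)x\in C^2(\mathbb R;X)$), and let $\mathcal K\ge 1$ be such that $\|C(t)\|\le\mathcal K$ for all $t\in\mathbb R$. Put $S(t)x=\int_0^t C(s)x\,ds$. Let $f:J\times X\to X$ and $\Theta_0,\Theta_1\in X$, and consider the system with the $\psi$-Caputo derivative of order $\alpha$ $$ {}^{C}\mathcal D^{\alpha,\psi}_{0^+}\Theta(t)=A\Theta(t)+f(t,\Theta(t)),\quad t\in J,\qquad \Theta(0)=\Theta_0,\quad \Theta'(0)=\Theta_1. \tag{1}$$ For $0<q<1$ let $M_q(\theta)=\sum_{n\ge0}\frac{(-\theta)^n}{n!\,\Gamma(1-q(n+1))}$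 be Mainardi's Wright-type function (with $1/\Gamma=0$ at the poles of $\Gamma$); for $q=1$, $M_q(\theta)\,d\theta$ stands for the Dirac mass at $\theta=1$. Put $$C^\psi_q(t,0)x=\int_0^\infty M_q(\theta)\,C\big((\psi(t)-\psi(0))^q\theta\big)x\,d\theta,\qquad R^\psi_q(t,0)x=\int_0^t C^\psi_q(s,0)x\,\frac{\psi'(s)}{\psi'(0)}\,ds,$$ $$P^\psi_q(t,s)x=\int_0^\infty q\,\theta\,M_q(\theta)\,S\big((\psi(t)-\psi(s))^q\theta\big)x\,d\theta .$$ A mild solution of (1) is a function $\Theta\in C(J;X)$ such that, for all $t\in J$, $$\Theta(t)=C^\psi_q(t,0)\Theta_0+R^\psi_q(t,0)\Theta_1+\int_0^t(\psi(t)-\psi(s))^{q-1}P^\psi_q(t,s)f(s,\Theta(s))\,\psi'(s)\,ds .$$ For $\beta>0$ let $B_\beta=\{\Theta\in C(J;X):\ \sup_{t\in J}\|\Theta(t)\|\le\beta\}$. Assume: (H3) $f$ is continuous, and for every $\beta>0$ there is $N_\beta>0$ such that $\|f(t,x(t))-f(t,y(t))\|\le N_\beta\|x(t)-y(t)\|$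 for all $t\in J$ and all $x,y\in B_\beta$; (H4) the operator $S(t)$ is compact for every $t>0$ (no compactness of $C(t)$ is required; in particular this holds if $C(t)$ and $S(t)$ are both compact for every $t>0$); (H5) for every $\beta>0$ there is a function $h_\beta\in L^\infty(J;\mathbb R)$ such that $\|f(t,y(t))\|\le h_\beta(t)$ for all $t\in J$ and all $y\in B_\beta$, and there is a constant $\mathcal H>0$ with $\limsup_{\beta\to\infty}\|h_\beta\|_{L^\infty(J)}/\beta=\mathcal H$. If $$\frac{\mathcal H\,\mathcal K\,(\psi(T)-\psi(0))^{2q}}{\Gamma(2q+1)}<1,$$ then system (1) has exactly one mild solution. -/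

import Mathlib

open Set Filter Topology MeasureTheory
open scoped ENNReal

noncomputable section

/-- A strongly continuous cosine family of bounded linear operators on `X`. -/
structure CosineFamily (X : Type*) [NormedAddCommGroup X] [NormedSpace ℝ X] where
  /-- The operator `C(t)`. -/
  op : ℝ → X →L[ℝ] X
  op_zero : op 0 = ContinuousLinearMap.id ℝ X
  op_add_add_op_sub : ∀ s t : ℝ, op (t + s) + op (t - s) = (2 : ℝ) • (op t ∘L op s)
  strongly_continuous : ∀ x : X, Continuous fun t : ℝ => op t x

namespace CosineFamily

variable {X : Type*} [NormedAddCommGroup X] [NormedSpace ℝ X]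

/-- The sine family `S(t) x = ∫₀ᵗ C(s) x ds` associated with a cosine family. -/
def sine (C : CosineFamily X) (t : ℝ) (x : X) : X :=
  ∫ s in (0 : ℝ)..t, C.op s x

/-- The set of all `x` for which `t ↦ C(t) x` is twice continuously differentiable on `ℝ`. -/
def generatorDomain (C : CosineFamily X) : Submodule ℝ X where
  carrier := {x | ContDiff ℝ 2 fun t : ℝ => C.op t x}
  add_mem' := by
    intro x y hx hy
    have hx' : ContDiff ℝ 2 fun t : ℝ => C.op t x := hx
    have hy' : ContDiff ℝ 2 fun t : ℝ => C.op t y := hy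
    have h : (fun t : ℝ => C.op t (x + y)) = fun t : ℝ => C.op t x + C.op t y :=
      funext fun t => map_add (C.op t) x y
    change ContDiff ℝ 2 fun t : ℝ => C.op t (x + y)
    rw [h]
    exact hx'.add hy'
  zero_mem' := by
    change ContDiff ℝ 2 fun t : ℝ => C.op t 0
    simpa only [map_zero] using contDiff_const
  smul_mem' := by
    intro c x hx
    have hx' : ContDiff ℝ 2 fun t : ℝ => C.op t x := hx
    have h : (fun t : ℝ => C.op t (c • x)) = fun t : ℝ => c • C.op t x :=
      funext fun t => map_smul (C.op t) c x
    change ContDiff ℝ 2 fun t : ℝ => C.op t (c • x)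
    rw [h]
    exact contDiff_const.smul hx'

/-- The infinitesimal generator `A x = (d²/dt²) C(t) x` at `t = 0`. -/
def generator (C : CosineFamily X) : X →ₗ.[ℝ] X where
  domain := C.generatorDomain
  toFun :=
    { toFun := fun x => iteratedDeriv 2 (fun t : ℝ => C.op t (x : X)) 0
      map_add' := by
        intro x y
        have hx : ContDiff ℝ 2 fun t : ℝ => C.op t (x : X) := x.2
        have hy : ContDiff ℝ 2 fun t : ℝ => C.op t (y : X) := y.2
        have h : (fun t : ℝ => C.op t ((x + y : C.generatorDomain) : X)) =
            fun t : ℝ => C.op t (x : X) + C.op t (y : X) :=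
          funext fun t => map_add (C.op t) (x : X) (y : X)
        rw [h, iteratedDeriv_fun_add hx.contDiffAt hy.contDiffAt]
      map_smul' := by
        intro c x
        have h : (fun t : ℝ => C.op t ((c • x : C.generatorDomain) : X)) =
            fun t : ℝ => c • C.op t (x : X) :=
          funext fun t => map_smul (C.op t) c (x : X)
        rw [h, RingHom.id_apply, iteratedDeriv_fun_const_smul_field] }

end CosineFamily

/-- Mainardi's Wright-type function `M_q(z) = ∑ (-z)ⁿ / (n! Γ(1 - q (n + 1)))`. At the poles of `Γ`
Mathlib's value is `0`, so that the quotient is `0`, which is the value of the entire function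
`1 / Γ` there. -/
def mainardi (q z : ℝ) : ℝ :=
  ∑' n : ℕ, (-z) ^ n / ((n.factorial : ℝ) * Real.Gamma (1 - q * ((n : ℝ) + 1)))

section Operators

variable {X : Type*} [NormedAddCommGroup X] [NormedSpace ℝ X]

/-- The integral `∫₀^∞ M_q(θ) g(θ) dθ` against Mainardi's probability distribution. For `q = 1` this
distribution has no density: it is the Dirac mass at `θ = 1`. -/
def mainardiIntegral (q : ℝ) (g : ℝ → X) : X :=
  if q = 1 then g 1 else ∫ θ in Ioi (0 : ℝ), mainardi q θ • g θ

/-- `C_q^ψ(t,0) x = ∫₀^∞ M_q(θ) C((ψ(t) - ψ(0))^q θ) x dθ`. -/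
def cosineResolvent (C : CosineFamily X) (ψ : ℝ → ℝ) (q t : ℝ) (x : X) : X :=
  mainardiIntegral q fun θ => C.op ((ψ t - ψ 0) ^ q * θ) x

/-- `R_q^ψ(t,0) x = ∫₀ᵗ (ψ'(s) / ψ'(0)) C_q^ψ(s,0) x ds`, where `ψ'` is the derivative of `ψ`
on the interval `[0,T]`. -/
def sineResolvent (C : CosineFamily X) (T : ℝ) (ψ : ℝ → ℝ) (q t : ℝ) (x : X) : X :=
  ∫ s in (0 : ℝ)..t,
    (derivWithin ψ (Icc 0 T) s / derivWithin ψ (Icc 0 T) 0) • cosineResolvent C ψ q s x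

/-- `P_q^ψ(t,s) x = ∫₀^∞ q θ M_q(θ) S((ψ(t) - ψ(s))^q θ) x dθ`. -/
def sourceResolvent (C : CosineFamily X) (ψ : ℝ → ℝ) (q t s : ℝ) (x : X) : X :=
  mainardiIntegral q fun θ => (q * θ) • C.sine ((ψ t - ψ s) ^ q * θ) x

/-- `Θ ∈ C([0,T]; X)` is a mild solution of the `ψ`-Caputo system of order `α = 2 q` governed by the
generator of `C`, with nonlinearity `f` and initial data `Θ₀`, `Θ₁`:
`Θ(t) = C_q^ψ(t,0) Θ₀ + R_q^ψ(t,0) Θ₁ + ∫₀ᵗ (ψ(t) - ψ(s))^(q-1) P_q^ψ(t,s) f(s,Θ(s)) ψ'(s) ds`.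
(`IccExtend` only makes `s ↦ f(s,Θ(s))`, a function on `[0,T]`, a function of a real variable; the
integral sees it on `[0,t] ⊆ [0,T]` alone.) -/
def IsMildSolution (C : CosineFamily X) {T : ℝ} (hT : 0 < T) (ψ : ℝ → ℝ) (q : ℝ)
    (f : Icc (0 : ℝ) T → X → X) (Θ₀ Θ₁ : X) (Θ : C(Icc (0 : ℝ) T, X)) : Prop :=
  ∀ t : Icc (0 : ℝ) T,
    Θ t = cosineResolvent C ψ q t Θ₀ + sineResolvent C T ψ q t Θ₁
      + ∫ s in (0 : ℝ)..t, ((ψ t - ψ s) ^ (q - 1) * derivWithin ψ (Icc 0 T) s) •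
          sourceResolvent C ψ q t s (IccExtend hT.le (fun r : Icc (0 : ℝ) T => f r (Θ r)) s)

/-- `f` is continuous, and Lipschitz in the second variable along functions in each ball `B_β` of
`C([0,T]; X)`. -/
def LocallyLipschitzOnBalls {T : ℝ} (f : Icc (0 : ℝ) T → X → X) : Prop :=
  Continuous (fun p : Icc (0 : ℝ) T × X => f p.1 p.2) ∧
    ∀ β : ℝ, 0 < β → ∃ N : ℝ, 0 < N ∧
      ∀ x y : C(Icc (0 : ℝ) T, X), ‖x‖ ≤ β → ‖y‖ ≤ β →
        ∀ t : Icc (0 : ℝ) T, ‖f t (x t) - f t (y t)‖ ≤ N * ‖x t - y t‖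

/-- There are functions `h_β ∈ L^∞(0,T)`, `β > 0`, with `‖f(t,y(t))‖ ≤ h_β(t)` for all `t` and all
`y` in the ball `B_β` of `C([0,T]; X)`, such that `lim sup ‖h_β‖_∞ / β = H` as `β → ∞`
(computed in `[0,∞]`). -/
def HasGrowthBound {T : ℝ} (f : Icc (0 : ℝ) T → X → X) (H : ℝ) : Prop :=
  ∃ h : ℝ → ℝ → ℝ,
    (∀ β : ℝ, 0 < β → MemLp (h β) ∞ (volume.restrict (Icc (0 : ℝ) T)) ∧
      ∀ y : C(Icc (0 : ℝ) T, X), ‖y‖ ≤ β → ∀ t : Icc (0 : ℝ) T, ‖f t (y t)‖ ≤ h β t) ∧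
    limsup (fun β : ℝ => eLpNorm (h β) ∞ (volume.restrict (Icc (0 : ℝ) T)) / ENNReal.ofReal β)
      atTop = ENNReal.ofReal H

end Operators

end

/-!
The equation of mild solutions is a Volterra equation `Θ(t) = a(t) + ∫₀ᵗ k(t,s) f(s,Θ(s)) ds` with
the operator kernel `k(t,s) = ψ'(s) (ψ(t) - ψ(s))^(q-1) P_q^ψ(t,s)`. The estimate
`‖k(t,s)‖ ≤ (K / Γ(2q)) ψ'(s) (ψ(t) - ψ(s))^(2q-1)` gives
`∫₀ᵗ ‖k(t,s)‖ ds ≤ Λ := K (ψ(T) - ψ(0))^(2q) / Γ(2q+1)`, so `H Λ < 1` makes the integral operator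
map every large ball of `C([0,T]; X)` into itself. As `2q > 1`, the kernel is bounded and
continuous (the singularity of `u^(q-1)` is absorbed by `‖S(u^q θ)‖ ≤ K u^q θ`), and as `f` is
Lipschitz on balls, the `n`-th iterate of the operator has Lipschitz constant at most `(L T)ⁿ / n!`
on such a ball; so each large ball contains exactly one fixed point, and there is exactly one
altogether. This is `existsUnique_volterra`.

The bound of the kernel amounts to `M_q ≥ 0` on `(0, ∞)` and `∫₀^∞ q θ² M_q(θ) dθ ≤ 1 / Γ(2q)`. Both
facts are read off, without complex analysis, from a discrete approximation of `M_q`. The power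
series `W = 1 - (1 - z)^q` has nonnegative coefficients, and so have its powers; expanding `Wⁿ`
binomially and using Euler's limit `m^(1-s) [zᵐ] (1 - z)^(-s) → 1 / Γ(s)`, one finds
`m [zᵐ] Wⁿ → ∑ₖ (-θ)ᵏ / (k! Γ(-qk)) = q θ M_q(θ)` as `m → ∞` with `n = ⌊θ m^q⌋`
(`tendsto_natCast_mul_sibuyaCoeff`). Hence `M_q ≥ 0`. Moreover
`∑ₙ n Wⁿ = W / (1 - W)² = (1 - z)^(-2q) - (1 - z)^(-q)`, whose `m`-th coefficient is at most
`[zᵐ] (1 - z)^(-2q) ~ m^(2q-1) / Γ(2q)`, and the moment bound follows by Fatou's lemma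
(`lintegral_sq_mul_mainardi_le`). Together they make `M_q(θ) dθ` a finite measure
(`mainardiMeasure`), and the Dirac mass for `q = 1` fits into the same scheme.
-/

noncomputable section

/-! ### The binomial series with negative exponent -/

/-- The coefficient `s (s + 1) ⋯ (s + m - 1) / m!` of `zᵐ` in the expansion of `(1 - z)^(-s)`. -/
def risingBinom (s : ℝ) (m : ℕ) : ℝ := ∏ j ∈ Finset.range m, (s + j) / (j + 1)

lemma risingBinom_succ (s : ℝ) (m : ℕ) :
    risingBinom s (m + 1) = risingBinom s m * ((s + m) / (m + 1)) :=
  Finset.prod_range_succ _ _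

lemma risingBinom_nonneg {s : ℝ} (hs : 0 ≤ s) (m : ℕ) : 0 ≤ risingBinom s m :=
  Finset.prod_nonneg fun j _ => by positivity

lemma risingBinom_eq_multichoose (s : ℝ) (m : ℕ) : risingBinom s m = Ring.multichoose s m := by
  have h := Ring.factorial_nsmul_multichoose_eq_ascPochhammer s m
  rw [Polynomial.ascPochhammer_smeval_eq_eval, nsmul_eq_mul] at h
  have hm : (m.factorial : ℝ) ≠ 0 := by positivity
  refine mul_left_cancel₀ hm ?_
  rw [h]
  clear h hm
  induction m with
  | zero => simp [risingBinom]
  | succ m ih =>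
    rw [ascPochhammer_succ_eval, ← ih, risingBinom_succ, Nat.factorial_succ]
    push_cast
    field_simp

/-- The formal power series `(1 - X)^(-s)`. -/
def negBinomSeries (s : ℝ) : PowerSeries ℝ := PowerSeries.mk (risingBinom s)

lemma coeff_negBinomSeries (s : ℝ) (m : ℕ) :
    PowerSeries.coeff m (negBinomSeries s) = risingBinom s m :=
  PowerSeries.coeff_mk _ _

lemma negBinomSeries_eq_rescale (s : ℝ) :
    negBinomSeries s = PowerSeries.rescale (-1 : ℝ) (PowerSeries.binomialSeries ℝ (-s)) := by
  ext m
  rw [coeff_negBinomSeries, PowerSeries.coeff_rescale, PowerSeries.binomialSeries_coeff,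
    Ring.choose_neg', risingBinom_eq_multichoose]
  rcases Nat.even_or_odd m with h | h
  · simp [Int.negOnePow_even _ ((Int.even_coe_nat m).2 h), h.neg_one_pow]
  · have h' : Odd (m : ℤ) := by exact_mod_cast h
    simp [Int.negOnePow_odd _ h', h.neg_one_pow]

lemma negBinomSeries_add (s t : ℝ) :
    negBinomSeries (s + t) = negBinomSeries s * negBinomSeries t := by
  simp only [negBinomSeries_eq_rescale, neg_add, PowerSeries.binomialSeries_add, map_mul]

lemma negBinomSeries_zero : negBinomSeries 0 = 1 := by
  rw [negBinomSeries_eq_rescale, neg_zero, PowerSeries.binomialSeries_zero, map_one]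

lemma negBinomSeries_pow (s : ℝ) (k : ℕ) : negBinomSeries s ^ k = negBinomSeries (s * k) := by
  induction k with
  | zero => simp [negBinomSeries_zero]
  | succ k ih => rw [pow_succ, ih, ← negBinomSeries_add]; congr 1; push_cast; ring

/-! ### Powers of `1 - (1 - X)^q` -/

/-- The formal power series `1 - (1 - X)^q`; for `0 ≤ q ≤ 1` it is the generating function of a
probability distribution on the positive integers (Sibuya's distribution). -/
def sibuyaSeries (q : ℝ) : PowerSeries ℝ := 1 - negBinomSeries (-q)

/-- The coefficient of `Xᵐ` in `(1 - (1 - X)^q)ⁿ`. -/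
def sibuyaCoeff (q : ℝ) (n m : ℕ) : ℝ := PowerSeries.coeff m (sibuyaSeries q ^ n)

lemma risingBinom_neg_nonpos {q : ℝ} (hq0 : 0 ≤ q) (hq1 : q ≤ 1) (m : ℕ) :
    risingBinom (-q) (m + 1) ≤ 0 := by
  induction m with
  | zero => simpa [risingBinom] using hq0
  | succ m ih =>
    rw [risingBinom_succ]
    refine mul_nonpos_of_nonpos_of_nonneg ih (div_nonneg ?_ (by positivity))
    push_cast
    linarith [(Nat.cast_nonneg m : (0 : ℝ) ≤ m)]

lemma sibuyaCoeff_nonneg {q : ℝ} (hq0 : 0 ≤ q) (hq1 : q ≤ 1) (n m : ℕ) :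
    0 ≤ sibuyaCoeff q n m := by
  induction n generalizing m with
  | zero =>
    rw [sibuyaCoeff, pow_zero, PowerSeries.coeff_one]
    split_ifs <;> norm_num
  | succ n ih =>
    rw [sibuyaCoeff, pow_succ, PowerSeries.coeff_mul]
    refine Finset.sum_nonneg fun p _ => mul_nonneg (ih p.1) ?_
    rw [sibuyaSeries, map_sub, PowerSeries.coeff_one, coeff_negBinomSeries]
    rcases p.2 with _ | j
    · simp [risingBinom]
    · simpa using risingBinom_neg_nonpos hq0 hq1 j

lemma sibuyaCoeff_eq_sum (q : ℝ) (n m : ℕ) :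
    sibuyaCoeff q n m =
      ∑ k ∈ Finset.range (n + 1), (-1) ^ k * n.choose k * risingBinom (-(q * k)) m := by
  have h : sibuyaSeries q ^ n = ∑ k ∈ Finset.range (n + 1),
      ((-1) ^ k * n.choose k : ℝ) • negBinomSeries (-(q * k)) := by
    rw [sibuyaSeries, sub_eq_neg_add, add_pow]
    refine Finset.sum_congr rfl fun k _ => ?_
    rw [neg_pow, negBinomSeries_pow, neg_mul, one_pow, mul_one, PowerSeries.smul_eq_C_mul]
    simp only [map_mul, map_pow, map_neg, map_one, map_natCast]
    ring
  rw [sibuyaCoeff, h, map_sum]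
  refine Finset.sum_congr rfl fun k _ => ?_
  rw [PowerSeries.coeff_smul, coeff_negBinomSeries, smul_eq_mul]

lemma sum_natCast_mul_pow_mul_one_sub_sq {R : Type*} [CommRing R] (w : R) (N : ℕ) :
    (∑ n ∈ Finset.range N, (n : R) * w ^ n) * (1 - w) ^ 2
      = w - w ^ N * (N - (N - 1) * w) := by
  induction N with
  | zero => simp
  | succ N ih =>
    rw [Finset.sum_range_succ, add_mul, ih]
    push_cast
    ring

lemma coeff_mul_sibuyaSeries_pow (q : ℝ) (φ : PowerSeries ℝ) {m N : ℕ} (h : m < N) :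
    PowerSeries.coeff m (sibuyaSeries q ^ N * φ) = 0 := by
  have hX : (PowerSeries.X : PowerSeries ℝ) ∣ sibuyaSeries q := by
    rw [PowerSeries.X_dvd_iff, ← PowerSeries.coeff_zero_eq_constantCoeff_apply, sibuyaSeries,
      map_sub, coeff_negBinomSeries]
    simp [risingBinom]
  exact PowerSeries.X_pow_dvd_iff.1 ((pow_dvd_pow_of_dvd hX N).mul_right φ) m h

lemma sibuyaCoeff_eq_zero (q : ℝ) {n m : ℕ} (h : m < n) : sibuyaCoeff q n m = 0 := by
  simpa [sibuyaCoeff] using coeff_mul_sibuyaSeries_pow q 1 h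

/-- With `W = 1 - (1 - X)^q`, this is the coefficient of `Xᵐ` in
`∑ₙ n Wⁿ = W / (1 - W)² = (1 - X)^(-2q) - (1 - X)^(-q)`. -/
lemma sum_natCast_mul_sibuyaCoeff (q : ℝ) {m N : ℕ} (h : m < N) :
    ∑ n ∈ Finset.range N, n * sibuyaCoeff q n m = risingBinom (2 * q) m - risingBinom q m := by
  have hB : (1 - sibuyaSeries q) ^ 2 * negBinomSeries (2 * q) = 1 := by
    rw [sibuyaSeries, sub_sub_cancel, negBinomSeries_pow, ← negBinomSeries_add,
      ← negBinomSeries_zero]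
    congr 1
    push_cast
    ring
  have hW : sibuyaSeries q * negBinomSeries (2 * q)
      = negBinomSeries (2 * q) - negBinomSeries q := by
    rw [sibuyaSeries, sub_mul, one_mul, ← negBinomSeries_add]
    congr 2
    ring
  have key : ∑ n ∈ Finset.range N, (n : PowerSeries ℝ) * sibuyaSeries q ^ n
      = negBinomSeries (2 * q) - negBinomSeries q
        - sibuyaSeries q ^ N * ((N - (N - 1) * sibuyaSeries q) * negBinomSeries (2 * q)) := by
    rw [← hW, ← mul_assoc, ← sub_mul, ← sum_natCast_mul_pow_mul_one_sub_sq, mul_assoc, hB, mul_one]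
  have h2 := congrArg (PowerSeries.coeff m) key
  rw [map_sub, map_sub, coeff_mul_sibuyaSeries_pow q _ h, sub_zero, coeff_negBinomSeries,
    coeff_negBinomSeries, map_sum] at h2
  rw [← h2]
  refine Finset.sum_congr rfl fun n _ => ?_
  rw [sibuyaCoeff, ← nsmul_eq_mul, ← nsmul_eq_mul, map_nsmul]

/-! ### Growth of the coefficients -/

/-- Euler's limit formula, valid at the poles of `Γ` as well: there both sides are `0`. -/
lemma tendsto_rpow_mul_risingBinom (s : ℝ) :
    Tendsto (fun m : ℕ => (m : ℝ) ^ (1 - s) * risingBinom s m) atTop (𝓝 (Real.Gamma s)⁻¹) := by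
  by_cases hs : ∃ k : ℕ, s = -k
  · obtain ⟨k, rfl⟩ := hs
    rw [Real.Gamma_neg_nat_eq_zero, inv_zero]
    refine tendsto_const_nhds.congr' ?_
    filter_upwards [eventually_gt_atTop k] with m hm
    rw [risingBinom, Finset.prod_eq_zero (Finset.mem_range.2 hm) (by simp), mul_zero]
  · push Not at hs
    have h1 := (Real.GammaSeq_tendsto_Gamma s).inv₀ (Real.Gamma_ne_zero hs)
    have h2 : Tendsto (fun m : ℕ => (m : ℝ) / (m + s)) atTop (𝓝 1) :=
      tendsto_natCast_div_add_atTop s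
    have h3 := h1.mul h2
    rw [mul_one] at h3
    refine h3.congr' ?_
    filter_upwards [eventually_gt_atTop 0] with m hm
    have hm' : (0 : ℝ) < m := by exact_mod_cast hm
    have hne : (m : ℝ) + s ≠ 0 := fun h => hs m (by linarith)
    have hne' : s + (m : ℝ) ≠ 0 := by rwa [add_comm]
    have hfac : ∏ j ∈ Finset.range m, ((j : ℝ) + 1) = m.factorial := by
      rw [← Finset.prod_range_add_one_eq_factorial]; push_cast; rfl
    rw [Real.GammaSeq, risingBinom, Finset.prod_div_distrib, hfac, Finset.prod_range_succ,
      Real.rpow_sub hm', Real.rpow_one]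
    have h4 : (m : ℝ) ^ s ≠ 0 := (Real.rpow_pos_of_pos hm' s).ne'
    have h5 : (m.factorial : ℝ) ≠ 0 := by positivity
    rw [add_comm (m : ℝ) s]
    field_simp

/-- A bound for the coefficients of `(1 - z)^x`, uniform in `m`. -/
lemma rpow_mul_abs_risingBinom_le {x : ℝ} (hx : 0 ≤ x) (m : ℕ) :
    ((m : ℝ) + 1) ^ (1 + x) * |risingBinom (-x) m| ≤ (Real.exp 1 * (x + 3)) ^ (1 + x) := by
  have hy : 0 ≤ 1 + x := by linarith
  -- as long as `m ≤ 2 + x`, the numerator of the coefficient is at most `(1 + x) ^ m`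
  have small : ∀ m : ℕ, (m : ℝ) ≤ 2 + x →
      ((m : ℝ) + 1) ^ (1 + x) * |risingBinom (-x) m| ≤ (Real.exp 1 * (x + 3)) ^ (1 + x) := by
    intro m hm
    have h1 : |risingBinom (-x) m| ≤ (1 + x) ^ m / m.factorial := by
      have hfac : (m.factorial : ℝ) = ∏ j ∈ Finset.range m, ((j : ℝ) + 1) := by
        rw [← Finset.prod_range_add_one_eq_factorial]; push_cast; rfl
      have hpow : (1 + x) ^ m = ∏ j ∈ Finset.range m, (1 + x) := by simp
      rw [risingBinom, Finset.abs_prod, hfac, hpow, ← Finset.prod_div_distrib]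
      refine Finset.prod_le_prod (fun _ _ => abs_nonneg _) fun j hj => ?_
      have hjm : (j : ℝ) + 1 ≤ m := by exact_mod_cast Finset.mem_range.1 hj
      have hj0 : (0 : ℝ) ≤ j := j.cast_nonneg
      rw [abs_div, abs_of_pos (by positivity : (0 : ℝ) < (j : ℝ) + 1)]
      gcongr
      rw [abs_le]
      constructor <;> linarith
    have h2 : |risingBinom (-x) m| ≤ Real.exp (1 + x) :=
      h1.trans (Real.pow_div_factorial_le_exp _ hy m)
    rw [Real.mul_rpow (Real.exp_pos 1).le (by linarith), ← Real.exp_mul, one_mul, mul_comm]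
    have h3 : (m : ℝ) + 1 ≤ x + 3 := by linarith
    gcongr
  induction m with
  | zero => exact small 0 (by push_cast; linarith)
  | succ m ih =>
    rcases le_total ((m : ℝ) + 1) (1 + x) with h | h
    · exact small _ (by push_cast; linarith)
    · refine le_trans ?_ ih
      have hm : (0 : ℝ) < m + 1 := by positivity
      rw [risingBinom_succ, abs_mul, mul_comm |risingBinom (-x) m|, ← mul_assoc]
      gcongr
      -- the ratio of consecutive terms is at most `(1 + 1/(m+1))^(1+x) (1 - (1+x)/(m+1)) ≤ 1`
      have h1 : |(-x + m) / (m + 1)| = 1 - (1 + x) / (m + 1) := by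
        rw [abs_of_nonneg (div_nonneg (by linarith) hm.le)]
        field_simp
        ring
      have h2 : 1 - (1 + x) / (m + 1) ≤ Real.exp (-((1 + x) / (m + 1))) := by
        linarith [Real.add_one_le_exp (-((1 + x) / ((m : ℝ) + 1)))]
      have h3 : ((m : ℝ) + 1 + 1) ≤ (m + 1) * Real.exp (1 / (m + 1)) := by
        have := Real.add_one_le_exp (1 / ((m : ℝ) + 1))
        calc ((m : ℝ) + 1 + 1) = (m + 1) * (1 / (m + 1) + 1) := by field_simp; ring
          _ ≤ _ := by gcongr
      have h4 : 0 ≤ 1 - (1 + x) / ((m : ℝ) + 1) := h1 ▸ abs_nonneg _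
      push_cast
      rw [h1]
      calc ((m : ℝ) + 1 + 1) ^ (1 + x) * (1 - (1 + x) / (m + 1))
          ≤ ((m + 1) * Real.exp (1 / (m + 1))) ^ (1 + x) * Real.exp (-((1 + x) / (m + 1))) := by
            gcongr
        _ = ((m : ℝ) + 1) ^ (1 + x) := by
            rw [Real.mul_rpow hm.le (Real.exp_pos _).le, ← Real.exp_mul, mul_assoc, ← Real.exp_add]
            rw [show 1 / ((m : ℝ) + 1) * (1 + x) + -((1 + x) / (m + 1)) = 0 by ring, Real.exp_zero,
              mul_one]

/-! ### Positivity of Mainardi's function -/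

/-- The factorial in the denominator beats the bound of `rpow_mul_abs_risingBinom_le`, since
`q < 1`. -/
lemma summable_pow_div_factorial_mul_rpow {q r : ℝ} (hq0 : 0 < q) (hq1 : q < 1) (hr : 0 < r) :
    Summable fun k : ℕ => r ^ k / k.factorial * (Real.exp 1 * (q * k + 3)) ^ (1 + q * k) := by
  -- a majorant for which the ratio test is convenient; it comes from `Nᴺ ≤ eᴺ N!`, `N = k + 3`
  set w : ℕ → ℝ := fun k => r ^ k / k.factorial * ((Real.exp 1 * (k + 3)) *
    (Real.exp 1 ^ (2 * (k + 3)) * (k + 3).factorial) ^ q) with hw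
  have hwpos : ∀ k, 0 < w k := fun k => by positivity
  have hsum : Summable w := by
    refine summable_of_ratio_test_tendsto_lt_one zero_lt_one
      (Eventually.of_forall fun k => (hwpos k).ne') ?_
    have hlim : Tendsto (fun k : ℕ => 8 * r * (Real.exp 1 ^ 2) ^ q * ((k : ℝ) + 4) ^ (-(1 - q)))
        atTop (𝓝 0) := by
      have h1 : Tendsto (fun k : ℕ => (k : ℝ) + 4) atTop atTop :=
        tendsto_atTop_add_const_right _ _ tendsto_natCast_atTop_atTop
      have h2 := ((tendsto_rpow_neg_atTop (by linarith : (0 : ℝ) < 1 - q)).comp h1).const_mul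
        (8 * r * (Real.exp 1 ^ 2) ^ q)
      rwa [mul_zero] at h2
    refine squeeze_zero (fun k => by positivity) (fun k => ?_) hlim
    rw [Real.norm_of_nonneg (hwpos _).le, Real.norm_of_nonneg (hwpos _).le, div_le_iff₀ (hwpos k)]
    have hk : (0 : ℝ) ≤ k := k.cast_nonneg
    have e1 : Real.exp 1 ^ (2 * (k + 1 + 3)) * ((k + 1 + 3).factorial : ℝ)
        = (Real.exp 1 ^ 2 * (k + 4)) * (Real.exp 1 ^ (2 * (k + 3)) * (k + 3).factorial) := by
      rw [show k + 1 + 3 = (k + 3) + 1 by ring, Nat.factorial_succ]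
      push_cast
      ring
    have e2 : ((k : ℝ) + 4) ^ q = (k + 4) ^ (-(1 - q)) * (k + 4) := by
      rw [← Real.rpow_add_one (by positivity)]
      congr 1
      ring
    simp only [hw]
    rw [e1, Real.mul_rpow (by positivity) (by positivity),
      Real.mul_rpow (by positivity) (by positivity), e2, Nat.factorial_succ, pow_succ]
    push_cast
    have hA : 0 < (Real.exp 1 ^ 2) ^ q := by positivity
    have hB : 0 < (Real.exp 1 ^ (2 * (k + 3)) * ((k + 3).factorial : ℝ)) ^ q := by positivity
    have hD : 0 < ((k : ℝ) + 4) ^ (-(1 - q)) := by positivity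
    generalize (Real.exp 1 ^ 2) ^ q = A at *
    generalize (Real.exp 1 ^ (2 * (k + 3)) * ((k + 3).factorial : ℝ)) ^ q = B at *
    generalize ((k : ℝ) + 4) ^ (-(1 - q)) = D at *
    have key : ((k : ℝ) + 4) * (k + 4) / (k + 1) ≤ 8 * (k + 3) := by
      rw [div_le_iff₀ (by positivity)]
      nlinarith
    calc r ^ k * r / ((k + 1) * k.factorial) * (Real.exp 1 * (k + 1 + 3) * (A * (D * (k + 4)) * B))
        = (r * A * D * (r ^ k / k.factorial) * Real.exp 1 * B) *
            (((k : ℝ) + 4) * (k + 4) / (k + 1)) := by field_simp; ring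
      _ ≤ (r * A * D * (r ^ k / k.factorial) * Real.exp 1 * B) * (8 * (k + 3)) := by gcongr
      _ = _ := by ring
  refine Summable.of_nonneg_of_le (fun k => by positivity) (fun k => ?_) hsum
  simp only [hw]
  gcongr
  have hk : (0 : ℝ) ≤ k := k.cast_nonneg
  have hN : (1 : ℝ) ≤ Real.exp 1 * (k + 3) := by
    nlinarith [Real.add_one_le_exp (1 : ℝ)]
  have h1 : Real.exp 1 * (q * k + 3) ≤ Real.exp 1 * (k + 3) := by
    gcongr
    nlinarith
  have h2 : (Real.exp 1 * ((k : ℝ) + 3)) ^ (k + 3)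
      ≤ Real.exp 1 ^ (2 * (k + 3)) * (k + 3).factorial := by
    have h := Real.pow_div_factorial_le_exp ((k : ℝ) + 3) (by positivity) (k + 3)
    rw [div_le_iff₀ (by positivity)] at h
    have h3 : Real.exp ((k : ℝ) + 3) = Real.exp 1 ^ (k + 3) := by
      rw [← Real.exp_nat_mul]
      push_cast
      ring_nf
    rw [h3] at h
    rw [mul_pow, two_mul, pow_add (Real.exp 1) (k + 3) (k + 3), mul_assoc]
    exact mul_le_mul_of_nonneg_left h (by positivity)
  calc (Real.exp 1 * (q * k + 3)) ^ (1 + q * k)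
      ≤ (Real.exp 1 * (k + 3)) ^ (1 + q * k) := by gcongr
    _ ≤ (Real.exp 1 * (k + 3)) ^ (1 + ((k + 3 : ℕ) : ℝ) * q) := by
        refine Real.rpow_le_rpow_of_exponent_le hN ?_
        push_cast
        nlinarith
    _ = Real.exp 1 * (k + 3) * ((Real.exp 1 * (k + 3)) ^ (k + 3)) ^ q := by
        rw [Real.rpow_add (by positivity), Real.rpow_one, Real.rpow_mul (by positivity),
          Real.rpow_natCast]
    _ ≤ _ := by gcongr

lemma abs_inv_Gamma_neg_le {x : ℝ} (hx : 0 ≤ x) :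
    |(Real.Gamma (-x))⁻¹| ≤ (Real.exp 1 * (x + 3)) ^ (1 + x) := by
  refine le_of_tendsto (tendsto_rpow_mul_risingBinom (-x)).abs (Eventually.of_forall fun m => ?_)
  refine le_trans ?_ (rpow_mul_abs_risingBinom_le hx m)
  rw [abs_mul, sub_neg_eq_add, abs_of_nonneg (Real.rpow_nonneg m.cast_nonneg _)]
  gcongr
  linarith

/-- The series of `1 / Γ(-q k)` is that of Mainardi's function, multiplied by `q z`. -/
lemma pow_succ_div_factorial_mul_inv_Gamma {q : ℝ} (hq0 : 0 < q) (z : ℝ) (n : ℕ) :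
    (-z) ^ (n + 1) / ((n + 1).factorial : ℝ) * (Real.Gamma (-(q * ((n + 1 : ℕ) : ℝ))))⁻¹
      = q * z * ((-z) ^ n / ((n.factorial : ℝ) * Real.Gamma (1 - q * ((n : ℝ) + 1)))) := by
  have hne : -(q * ((n : ℝ) + 1)) ≠ 0 := by
    have : 0 < q * ((n : ℝ) + 1) := by positivity
    linarith
  have h := Real.Gamma_add_one hne
  rw [show -(q * ((n : ℝ) + 1)) + 1 = 1 - q * (n + 1) by ring] at h
  rw [h, Nat.factorial_succ]
  push_cast
  by_cases hG : Real.Gamma (-(q * ((n : ℝ) + 1))) = 0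
  · simp [hG]
  · field_simp
    ring

lemma summable_pow_div_factorial_mul_inv_Gamma {q : ℝ} (hq0 : 0 < q) (hq1 : q < 1) (z : ℝ) :
    Summable fun k : ℕ => (-z) ^ k / (k.factorial : ℝ) * (Real.Gamma (-(q * (k : ℝ))))⁻¹ := by
  refine Summable.of_norm_bounded
    (summable_pow_div_factorial_mul_rpow hq0 hq1 (by positivity : 0 < |z| + 1)) fun k => ?_
  rw [norm_mul, Real.norm_eq_abs, Real.norm_eq_abs, abs_div, abs_pow, abs_neg,
    abs_of_pos (by positivity : (0 : ℝ) < k.factorial)]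
  gcongr
  · linarith
  · exact abs_inv_Gamma_neg_le (by positivity)

lemma abs_mainardi_term_le {q : ℝ} {z r : ℝ} (h : |z| ≤ r) (n : ℕ) :
    ‖(-z) ^ n / ((n.factorial : ℝ) * Real.Gamma (1 - q * ((n : ℝ) + 1)))‖ ≤
      ‖(-r) ^ n / ((n.factorial : ℝ) * Real.Gamma (1 - q * ((n : ℝ) + 1)))‖ := by
  have hr : 0 ≤ r := (abs_nonneg z).trans h
  rw [norm_div, norm_div, norm_pow, norm_pow, norm_neg, norm_neg, Real.norm_eq_abs z,
    Real.norm_of_nonneg hr]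
  gcongr

lemma summable_mainardi {q : ℝ} (hq0 : 0 < q) (hq1 : q < 1) (z : ℝ) :
    Summable fun n : ℕ => (-z) ^ n / ((n.factorial : ℝ) * Real.Gamma (1 - q * ((n : ℝ) + 1))) := by
  have hr : 0 < |z| + 1 := by positivity
  have h := (summable_nat_add_iff 1).2
    (summable_pow_div_factorial_mul_inv_Gamma hq0 hq1 (|z| + 1))
  simp only [pow_succ_div_factorial_mul_inv_Gamma hq0] at h
  rw [summable_mul_left_iff (by positivity)] at h
  exact Summable.of_norm_bounded h.norm fun n => abs_mainardi_term_le (by linarith) n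

lemma measurable_mainardi {q : ℝ} (hq0 : 0 < q) (hq1 : q < 1) : Measurable (mainardi q) := by
  refine measurable_of_tendsto_metrizable (f := fun N z => ∑ n ∈ Finset.range N,
    (-z) ^ n / ((n.factorial : ℝ) * Real.Gamma (1 - q * ((n : ℝ) + 1)))) (fun N => ?_) ?_
  · fun_prop
  · exact tendsto_pi_nhds.2 fun z => (summable_mainardi hq0 hq1 z).hasSum.tendsto_sum_nat

lemma exists_abs_mainardi_le {q : ℝ} (hq0 : 0 < q) (hq1 : q < 1) (r : ℝ) :
    ∃ c, ∀ z, |z| ≤ r → |mainardi q z| ≤ c :=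
  ⟨_, fun _ hz => tsum_of_norm_bounded (summable_mainardi hq0 hq1 r).norm.hasSum
    fun n => abs_mainardi_term_le hz n⟩

/-- `m` times the coefficient of `zᵐ` in `(1 - (1 - z)^q)ⁿ` tends to `q θ M_q(θ)` if `n ~ θ m^q`:
after expanding the power binomially, the series converges term by term, and
`rpow_mul_abs_risingBinom_le` provides a summable majorant. -/
lemma tendsto_natCast_mul_sibuyaCoeff {q θ : ℝ} (hq0 : 0 < q) (hq1 : q < 1) (hθ : 0 < θ) :
    Tendsto (fun m : ℕ => (m : ℝ) * sibuyaCoeff q ⌊θ * (m : ℝ) ^ q⌋₊ m) atTop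
      (𝓝 (q * θ * mainardi q θ)) := by
  have hpow : Tendsto (fun m : ℕ => (m : ℝ) ^ q) atTop atTop :=
    (tendsto_rpow_atTop hq0).comp tendsto_natCast_atTop_atTop
  have hn : Tendsto (fun m : ℕ => ⌊θ * (m : ℝ) ^ q⌋₊) atTop atTop :=
    tendsto_nat_floor_atTop.comp (hpow.const_mul_atTop hθ)
  have hratio : Tendsto (fun m : ℕ => (⌊θ * (m : ℝ) ^ q⌋₊ : ℝ) / (m : ℝ) ^ q) atTop (𝓝 θ) :=
    (tendsto_nat_floor_mul_div_atTop hθ.le).comp hpow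
  have hval : q * θ * mainardi q θ
      = ∑' k : ℕ, (-θ) ^ k / (k.factorial : ℝ) * (Real.Gamma (-(q * (k : ℝ))))⁻¹ := by
    rw [(summable_pow_div_factorial_mul_inv_Gamma hq0 hq1 θ).tsum_eq_zero_add, mainardi,
      ← tsum_mul_left]
    simp only [pow_succ_div_factorial_mul_inv_Gamma hq0]
    simp
  have hsum : ∀ m : ℕ, (m : ℝ) * sibuyaCoeff q ⌊θ * (m : ℝ) ^ q⌋₊ m
      = ∑' k : ℕ, (m : ℝ) * ((-1) ^ k * (⌊θ * (m : ℝ) ^ q⌋₊.choose k) *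
          risingBinom (-(q * k)) m) := by
    intro m
    rw [tsum_mul_left, sibuyaCoeff_eq_sum, tsum_eq_sum]
    intro k hk
    rw [Nat.choose_eq_zero_of_lt (by simpa using hk)]
    simp
  rw [hval, funext hsum]
  refine tendsto_tsum_of_dominated_convergence
    (summable_pow_div_factorial_mul_rpow hq0 hq1 hθ) (fun k => ?_) ?_
  · -- `C(n,k) ~ nᵏ / k! ~ θᵏ m^(q k) / k!`
    have h1 : Tendsto (fun m : ℕ => (⌊θ * (m : ℝ) ^ q⌋₊.choose k : ℝ) / ((m : ℝ) ^ q) ^ k) atTop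
        (𝓝 (θ ^ k / k.factorial)) := by
      have h := ((Asymptotics.isEquivalent_iff_tendsto_one (by
        filter_upwards [eventually_gt_atTop 0] with n hn
        positivity)).1 (isEquivalent_choose k)).comp hn
      have h' := h.mul ((hratio.pow k).div_const (k.factorial : ℝ))
      rw [one_mul] at h'
      refine h'.congr' ?_
      filter_upwards [hn.eventually_gt_atTop 0, eventually_gt_atTop 0] with m hm hm0
      have hm1 : (0 : ℝ) < m := by exact_mod_cast hm0
      have hm2 : (0 : ℝ) < (m : ℝ) ^ q := by positivity
      have hm3 : (0 : ℝ) < (⌊θ * (m : ℝ) ^ q⌋₊ : ℝ) := by exact_mod_cast hm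
      simp only [Function.comp_apply, Pi.div_apply, div_pow]
      field_simp
    have h2 := (h1.const_mul ((-1) ^ k)).mul (tendsto_rpow_mul_risingBinom (-(q * k)))
    rw [← mul_div_assoc, ← neg_pow] at h2
    refine h2.congr' ?_
    filter_upwards [eventually_gt_atTop 0] with m hm0
    have hm1 : (0 : ℝ) < m := by exact_mod_cast hm0
    have hm2 : (0 : ℝ) < (m : ℝ) ^ q := by positivity
    rw [sub_neg_eq_add, Real.rpow_add hm1, Real.rpow_one, Real.rpow_mul hm1.le, Real.rpow_natCast]
    field_simp
  · filter_upwards [eventually_gt_atTop 0] with m hm0 k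
    have hm1 : (0 : ℝ) < m := by exact_mod_cast hm0
    have h1 : (⌊θ * (m : ℝ) ^ q⌋₊.choose k : ℝ) ≤ (θ * (m : ℝ) ^ q) ^ k / k.factorial := by
      refine (Nat.choose_le_pow_div k _).trans ?_
      gcongr
      exact Nat.floor_le (by positivity)
    have h2 : (m : ℝ) ^ (1 + q * k) * |risingBinom (-(q * k)) m|
        ≤ (Real.exp 1 * (q * k + 3)) ^ (1 + q * k) := by
      refine le_trans ?_ (rpow_mul_abs_risingBinom_le (by positivity : 0 ≤ q * k) m)
      gcongr
      linarith
    rw [Real.rpow_add hm1, Real.rpow_one, Real.rpow_mul hm1.le, Real.rpow_natCast] at h2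
    rw [norm_mul, norm_mul, norm_mul, norm_pow, norm_neg, norm_one, one_pow, one_mul,
      Real.norm_of_nonneg hm1.le, Real.norm_of_nonneg (Nat.cast_nonneg _), Real.norm_eq_abs]
    calc (m : ℝ) * (⌊θ * (m : ℝ) ^ q⌋₊.choose k * |risingBinom (-(q * k)) m|)
        ≤ m * ((θ * (m : ℝ) ^ q) ^ k / k.factorial * |risingBinom (-(q * k)) m|) := by gcongr
      _ = θ ^ k / k.factorial * (m * ((m : ℝ) ^ q) ^ k * |risingBinom (-(q * k)) m|) := by
          rw [mul_pow]
          ring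
      _ ≤ _ := by gcongr

lemma mainardi_nonneg {q θ : ℝ} (hq0 : 0 < q) (hq1 : q < 1) (hθ : 0 < θ) : 0 ≤ mainardi q θ := by
  have h : 0 ≤ q * θ * mainardi q θ :=
    ge_of_tendsto' (tendsto_natCast_mul_sibuyaCoeff hq0 hq1 hθ) fun m =>
      mul_nonneg m.cast_nonneg (sibuyaCoeff_nonneg hq0.le hq1.le _ m)
  exact nonneg_of_mul_nonneg_right h (by positivity)

/-! ### The second moment of Mainardi's function -/

lemma lintegral_comp_floor_mul_le {a : ℝ} (ha : 0 < a) (φ : ℕ → ℝ≥0∞) :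
    ∫⁻ θ in Ioi (0 : ℝ), φ ⌊θ * a⌋₊ ≤ ∑' n, φ n * ENNReal.ofReal a⁻¹ := by
  have hpt : ∀ θ ∈ Ioi (0 : ℝ), φ ⌊θ * a⌋₊
      ≤ ∑' n : ℕ, (Ico (n / a) ((n + 1) / a)).indicator (fun _ => φ n) θ := by
    intro θ hθ
    have hmem : θ ∈ Ico ((⌊θ * a⌋₊ : ℝ) / a) ((⌊θ * a⌋₊ + 1) / a) :=
      ⟨(div_le_iff₀ ha).2 (Nat.floor_le (mul_pos hθ ha).le),
        (lt_div_iff₀ ha).2 (Nat.lt_floor_add_one _)⟩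
    refine le_trans ?_ (ENNReal.le_tsum ⌊θ * a⌋₊)
    rw [indicator_of_mem hmem]
  calc ∫⁻ θ in Ioi (0 : ℝ), φ ⌊θ * a⌋₊
      ≤ ∫⁻ θ in Ioi (0 : ℝ),
          ∑' n : ℕ, (Ico (n / a) ((n + 1) / a)).indicator (fun _ => φ n) θ :=
        setLIntegral_mono' measurableSet_Ioi hpt
    _ ≤ ∫⁻ θ, ∑' n : ℕ, (Ico (n / a) ((n + 1) / a)).indicator (fun _ => φ n) θ :=
        setLIntegral_le_lintegral _ _
    _ = ∑' n, φ n * ENNReal.ofReal a⁻¹ := by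
        rw [lintegral_tsum fun n => (measurable_const.indicator measurableSet_Ico).aemeasurable]
        refine tsum_congr fun n => ?_
        rw [lintegral_indicator_const measurableSet_Ico, Real.volume_Ico]
        congr 2
        field_simp
        ring

/-- By Fatou's lemma, applied to the approximation of `tendsto_natCast_mul_sibuyaCoeff`: the
integrals of the approximating step functions are `∑ₙ n [zᵐ] (1 - (1 - z)^q)ⁿ`, suitably scaled, so
they are controlled by the coefficients of `(1 - z)^(-2q)`. -/
lemma lintegral_sq_mul_mainardi_le {q : ℝ} (hq0 : 0 < q) (hq1 : q < 1) :
    ∫⁻ θ in Ioi (0 : ℝ), ENNReal.ofReal (θ * (q * θ * mainardi q θ))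
      ≤ ENNReal.ofReal (Real.Gamma (2 * q))⁻¹ := by
  set φ : ℕ → ℕ → ℝ≥0∞ := fun m n =>
    ENNReal.ofReal (n / (m : ℝ) ^ q * (m * sibuyaCoeff q n m)) with hφ
  have hpow : Tendsto (fun m : ℕ => (m : ℝ) ^ q) atTop atTop :=
    (tendsto_rpow_atTop hq0).comp tendsto_natCast_atTop_atTop
  have hlim : ∀ θ ∈ Ioi (0 : ℝ), Tendsto (fun m : ℕ => φ m ⌊θ * (m : ℝ) ^ q⌋₊) atTop
      (𝓝 (ENNReal.ofReal (θ * (q * θ * mainardi q θ)))) := fun θ hθ =>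
    ENNReal.tendsto_ofReal (((tendsto_nat_floor_mul_div_atTop (le_of_lt hθ)).comp hpow).mul
      (tendsto_natCast_mul_sibuyaCoeff hq0 hq1 hθ))
  have hbound : ∀ m : ℕ, 0 < m → ∫⁻ θ in Ioi (0 : ℝ), φ m ⌊θ * (m : ℝ) ^ q⌋₊
      ≤ ENNReal.ofReal ((m : ℝ) ^ (1 - 2 * q) * risingBinom (2 * q) m) := by
    intro m hm
    have hm0 : (0 : ℝ) < m := by exact_mod_cast hm
    have ha : (0 : ℝ) < (m : ℝ) ^ q := by positivity
    refine (lintegral_comp_floor_mul_le ha (φ m)).trans ?_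
    have hnn : ∀ n : ℕ, 0 ≤ (n : ℝ) / (m : ℝ) ^ q * (m * sibuyaCoeff q n m) := fun n =>
      mul_nonneg (by positivity) (mul_nonneg hm0.le (sibuyaCoeff_nonneg hq0.le hq1.le n m))
    rw [ENNReal.tsum_mul_right, tsum_eq_sum (s := Finset.range (m + 1)), hφ,
      ← ENNReal.ofReal_sum_of_nonneg fun n _ => hnn n, ← ENNReal.ofReal_mul
        (Finset.sum_nonneg fun n _ => hnn n)]
    · refine ENNReal.ofReal_le_ofReal ?_
      have hsum := sum_natCast_mul_sibuyaCoeff q (Nat.lt_succ_self m)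
      have e : (m : ℝ) ^ (1 - 2 * q) = m / (m : ℝ) ^ q * ((m : ℝ) ^ q)⁻¹ := by
        rw [Real.rpow_sub hm0, Real.rpow_one, two_mul, Real.rpow_add hm0]
        field_simp
      calc (∑ n ∈ Finset.range (m + 1), (n : ℝ) / (m : ℝ) ^ q * (m * sibuyaCoeff q n m)) *
            ((m : ℝ) ^ q)⁻¹
          = (m : ℝ) ^ (1 - 2 * q) * ∑ n ∈ Finset.range (m + 1), n * sibuyaCoeff q n m := by
            rw [e, Finset.sum_mul, Finset.mul_sum]
            exact Finset.sum_congr rfl fun n _ => by ring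
        _ ≤ (m : ℝ) ^ (1 - 2 * q) * risingBinom (2 * q) m := by
            rw [hsum]
            gcongr
            linarith [risingBinom_nonneg hq0.le m]
    · intro n hn
      have hmn : m < n := by simpa using hn
      simp [hφ, sibuyaCoeff_eq_zero q hmn]
  calc ∫⁻ θ in Ioi (0 : ℝ), ENNReal.ofReal (θ * (q * θ * mainardi q θ))
      = ∫⁻ θ in Ioi (0 : ℝ), liminf (fun m : ℕ => φ m ⌊θ * (m : ℝ) ^ q⌋₊) atTop :=
        setLIntegral_congr_fun measurableSet_Ioi fun θ hθ => (hlim θ hθ).liminf_eq.symm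
    _ ≤ liminf (fun m : ℕ => ∫⁻ θ in Ioi (0 : ℝ), φ m ⌊θ * (m : ℝ) ^ q⌋₊) atTop :=
        lintegral_liminf_le fun m => (measurable_from_nat (f := φ m)).comp
          (Nat.measurable_floor.comp (measurable_id.mul_const _))
    _ ≤ liminf (fun m : ℕ => ENNReal.ofReal ((m : ℝ) ^ (1 - 2 * q) * risingBinom (2 * q) m))
          atTop := by
        refine liminf_le_liminf ?_
        filter_upwards [eventually_gt_atTop 0] with m hm using hbound m hm
    _ = ENNReal.ofReal (Real.Gamma (2 * q))⁻¹ :=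
        (ENNReal.tendsto_ofReal (tendsto_rpow_mul_risingBinom (2 * q))).liminf_eq

/-! ### Mainardi's distribution -/

/-- The measure with density `M_q` on `(0, ∞)`, and the Dirac mass at `1` if `q = 1`. -/
def mainardiMeasure (q : ℝ) : Measure ℝ :=
  if q = 1 then Measure.dirac 1
  else (volume.restrict (Ioi 0)).withDensity fun θ => ENNReal.ofReal (mainardi q θ)

lemma mainardiIntegral_eq_integral {X : Type*} [NormedAddCommGroup X] [NormedSpace ℝ X]
    [CompleteSpace X] {q : ℝ} (hq0 : 0 < q) (hq1 : q ≤ 1) (g : ℝ → X) :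
    mainardiIntegral q g = ∫ θ, g θ ∂mainardiMeasure q := by
  unfold mainardiIntegral mainardiMeasure
  split_ifs with h
  · rw [integral_dirac]
  · have hq1' : q < 1 := lt_of_le_of_ne hq1 h
    rw [integral_withDensity_eq_integral_toReal_smul (measurable_mainardi hq0 hq1').ennreal_ofReal
      (Eventually.of_forall fun _ => ENNReal.ofReal_lt_top)]
    refine setIntegral_congr_fun measurableSet_Ioi fun θ hθ => ?_
    simp only [ENNReal.toReal_ofReal (mainardi_nonneg hq0 hq1' hθ)]

lemma lintegral_sq_mainardiMeasure_le {q : ℝ} (hq0 : 0 < q) (hq1 : q ≤ 1) :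
    ∫⁻ θ, ENNReal.ofReal (q * θ ^ 2) ∂mainardiMeasure q
      ≤ ENNReal.ofReal (Real.Gamma (2 * q))⁻¹ := by
  unfold mainardiMeasure
  split_ifs with h
  · subst h
    rw [lintegral_dirac]
    simp
  · have hq1' : q < 1 := lt_of_le_of_ne hq1 h
    rw [lintegral_withDensity_eq_lintegral_mul _ (measurable_mainardi hq0 hq1').ennreal_ofReal
      (by fun_prop)]
    refine le_trans (le_of_eq ?_) (lintegral_sq_mul_mainardi_le hq0 hq1')
    refine setLIntegral_congr_fun measurableSet_Ioi fun θ hθ => ?_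
    simp only [Pi.mul_apply]
    rw [← ENNReal.ofReal_mul (mainardi_nonneg hq0 hq1' hθ)]
    ring_nf

lemma isFiniteMeasure_mainardiMeasure {q : ℝ} (hq0 : 0 < q) (hq1 : q ≤ 1) :
    IsFiniteMeasure (mainardiMeasure q) := by
  by_cases h : q = 1
  · rw [mainardiMeasure, if_pos h]
    infer_instance
  have hq1' : q < 1 := lt_of_le_of_ne hq1 h
  refine ⟨?_⟩
  -- the mass of `(0, 1]` is finite as the density is bounded there, the mass of `(1, ∞)` is at most
  -- the second moment
  obtain ⟨c, hc⟩ := exists_abs_mainardi_le hq0 hq1' 1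
  have h1 : mainardiMeasure q (Iic 1) < ∞ := by
    rw [mainardiMeasure, if_neg h, withDensity_apply _ measurableSet_Iic,
      Measure.restrict_restrict measurableSet_Iic, inter_comm, Ioi_inter_Iic]
    calc ∫⁻ θ in Ioc (0 : ℝ) 1, ENNReal.ofReal (mainardi q θ)
        ≤ ∫⁻ θ in Ioc (0 : ℝ) 1, ENNReal.ofReal c :=
          setLIntegral_mono' measurableSet_Ioc fun θ hθ => ENNReal.ofReal_le_ofReal
            ((le_abs_self _).trans (hc θ (abs_le.2 ⟨by linarith [hθ.1], hθ.2⟩)))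
      _ < ∞ := by simp
  have h2 : mainardiMeasure q (Ioi 1) < ∞ := by
    have h3 := (lintegral_sq_mainardiMeasure_le hq0 hq1).trans_lt ENNReal.ofReal_lt_top
    have h4 : ENNReal.ofReal q * mainardiMeasure q (Ioi 1)
        ≤ ∫⁻ θ, ENNReal.ofReal (q * θ ^ 2) ∂mainardiMeasure q := by
      rw [← setLIntegral_const]
      refine (setLIntegral_mono' measurableSet_Ioi fun θ hθ => ?_).trans
        (setLIntegral_le_lintegral _ _)
      have hθ' : (1 : ℝ) < θ := hθ
      exact ENNReal.ofReal_le_ofReal (le_mul_of_one_le_right hq0.le (by nlinarith))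
    exact ENNReal.lt_top_of_mul_ne_top_right (h4.trans_lt h3).ne (by simpa using hq0)
  rw [← Iic_union_Ioi (a := (1 : ℝ))]
  exact (measure_union_le _ _).trans_lt (ENNReal.add_lt_top.2 ⟨h1, h2⟩)

lemma integrable_sq_mainardiMeasure {q : ℝ} (hq0 : 0 < q) (hq1 : q ≤ 1) :
    Integrable (fun θ => q * θ ^ 2) (mainardiMeasure q) := by
  refine ⟨by fun_prop, ?_⟩
  rw [hasFiniteIntegral_iff_ofReal (Eventually.of_forall fun θ => by positivity)]
  exact (lintegral_sq_mainardiMeasure_le hq0 hq1).trans_lt ENNReal.ofReal_lt_top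

lemma integral_sq_mainardiMeasure_le {q : ℝ} (hq0 : 0 < q) (hq1 : q ≤ 1) :
    ∫ θ, q * θ ^ 2 ∂mainardiMeasure q ≤ (Real.Gamma (2 * q))⁻¹ := by
  rw [integral_eq_lintegral_of_nonneg_ae (Eventually.of_forall fun θ => by positivity)
    (by fun_prop)]
  refine ENNReal.toReal_le_of_le_ofReal ?_ (lintegral_sq_mainardiMeasure_le hq0 hq1)
  exact inv_nonneg.2 (Real.Gamma_nonneg_of_nonneg (by linarith))

/-! ### The source kernel -/

section SourceKernel

variable {X : Type*} [NormedAddCommGroup X] [NormedSpace ℝ X]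

namespace CosineFamily

lemma intervalIntegrable_op (C : CosineFamily X) (a b : ℝ) (x : X) :
    IntervalIntegrable (fun s => C.op s x) volume a b :=
  (C.strongly_continuous x).intervalIntegrable a b

lemma sine_zero (C : CosineFamily X) (x : X) : C.sine 0 x = 0 :=
  intervalIntegral.integral_same

lemma sine_sub (C : CosineFamily X) (t : ℝ) (x y : X) :
    C.sine t (x - y) = C.sine t x - C.sine t y := by
  simp only [sine, map_sub]
  exact intervalIntegral.integral_sub (C.intervalIntegrable_op _ _ _)
    (C.intervalIntegrable_op _ _ _)

lemma norm_sine_sub_sine_le (C : CosineFamily X) {K : ℝ} (hC : ∀ t, ‖C.op t‖ ≤ K) (a b : ℝ)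
    (x : X) : ‖C.sine a x - C.sine b x‖ ≤ K * ‖x‖ * |a - b| := by
  rw [sine, sine, intervalIntegral.integral_interval_sub_left (C.intervalIntegrable_op _ _ _)
    (C.intervalIntegrable_op _ _ _)]
  exact intervalIntegral.norm_integral_le_of_norm_le_const fun s _ =>
    (C.op s).le_of_opNorm_le (hC s) x

lemma continuous_sine (C : CosineFamily X) (x : X) : Continuous fun t => C.sine t x :=
  intervalIntegral.continuous_primitive (fun _ _ => C.intervalIntegrable_op _ _ x) 0

/-- The operator `x ↦ ∫₀^∞ q θ M_q(θ) S(τ θ) x dθ`, so that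
`P_q^ψ(t,s) = C.mainardiSine q ((ψ(t) - ψ(s))^q)`. -/
def mainardiSine (C : CosineFamily X) (q τ : ℝ) (x : X) : X :=
  ∫ θ, (q * θ) • C.sine (τ * θ) x ∂mainardiMeasure q

variable {C : CosineFamily X} {q K : ℝ}

lemma norm_smul_sine_sub_le (hq0 : 0 < q) (hC : ∀ t, ‖C.op t‖ ≤ K) (τ σ θ : ℝ) (x : X) :
    ‖(q * θ) • C.sine (τ * θ) x - (q * θ) • C.sine (σ * θ) x‖
      ≤ K * ‖x‖ * |τ - σ| * (q * θ ^ 2) := by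
  rw [← smul_sub, norm_smul, Real.norm_eq_abs, abs_mul, abs_of_pos hq0]
  calc q * |θ| * ‖C.sine (τ * θ) x - C.sine (σ * θ) x‖
      ≤ q * |θ| * (K * ‖x‖ * |τ * θ - σ * θ|) := by
        gcongr
        exact C.norm_sine_sub_sine_le hC _ _ _
    _ = K * ‖x‖ * |τ - σ| * (q * θ ^ 2) := by
        rw [← sub_mul, abs_mul, ← sq_abs θ]
        ring

lemma integrable_smul_sine (hq0 : 0 < q) (hq1 : q ≤ 1) (hC : ∀ t, ‖C.op t‖ ≤ K) (τ : ℝ) (x : X) :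
    Integrable (fun θ => (q * θ) • C.sine (τ * θ) x) (mainardiMeasure q) := by
  refine Integrable.mono' ((integrable_sq_mainardiMeasure hq0 hq1).const_mul (K * ‖x‖ * |τ - 0|))
    ?_ (Eventually.of_forall fun θ => ?_)
  · have := C.continuous_sine x
    exact Continuous.aestronglyMeasurable (by fun_prop)
  · simpa [sine_zero] using norm_smul_sine_sub_le hq0 hC τ 0 θ x

lemma mainardiSine_zero_left (x : X) : C.mainardiSine q 0 x = 0 := by
  simp [mainardiSine, sine_zero]

lemma mainardiSine_sub (hq0 : 0 < q) (hq1 : q ≤ 1) (hC : ∀ t, ‖C.op t‖ ≤ K) (τ : ℝ) (x y : X) :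
    C.mainardiSine q τ (x - y) = C.mainardiSine q τ x - C.mainardiSine q τ y := by
  simp only [mainardiSine, sine_sub, smul_sub]
  exact integral_sub (integrable_smul_sine hq0 hq1 hC τ x) (integrable_smul_sine hq0 hq1 hC τ y)

lemma norm_mainardiSine_sub_le (hq0 : 0 < q) (hq1 : q ≤ 1) (hC : ∀ t, ‖C.op t‖ ≤ K) (τ σ : ℝ)
    (x : X) : ‖C.mainardiSine q τ x - C.mainardiSine q σ x‖
      ≤ K / Real.Gamma (2 * q) * |τ - σ| * ‖x‖ := by
  have hK : 0 ≤ K := (norm_nonneg _).trans (hC 0)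
  rw [mainardiSine, mainardiSine, ← integral_sub (integrable_smul_sine hq0 hq1 hC τ x)
    (integrable_smul_sine hq0 hq1 hC σ x)]
  calc ‖∫ θ, ((q * θ) • C.sine (τ * θ) x - (q * θ) • C.sine (σ * θ) x) ∂mainardiMeasure q‖
      ≤ ∫ θ, K * ‖x‖ * |τ - σ| * (q * θ ^ 2) ∂mainardiMeasure q :=
        norm_integral_le_of_norm_le ((integrable_sq_mainardiMeasure hq0 hq1).const_mul _)
          (Eventually.of_forall fun θ => norm_smul_sine_sub_le hq0 hC τ σ θ x)
    _ ≤ K * ‖x‖ * |τ - σ| * (Real.Gamma (2 * q))⁻¹ := by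
        rw [integral_const_mul]
        gcongr
        exact integral_sq_mainardiMeasure_le hq0 hq1
    _ = _ := by ring

lemma norm_mainardiSine_le (hq0 : 0 < q) (hq1 : q ≤ 1) (hC : ∀ t, ‖C.op t‖ ≤ K) (τ : ℝ)
    (x : X) : ‖C.mainardiSine q τ x‖ ≤ K / Real.Gamma (2 * q) * |τ| * ‖x‖ := by
  simpa [mainardiSine_zero_left] using norm_mainardiSine_sub_le hq0 hq1 hC τ 0 x

lemma continuous_mainardiSine (hq0 : 0 < q) (hq1 : q ≤ 1) (hC : ∀ t, ‖C.op t‖ ≤ K) :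
    Continuous fun p : ℝ × X => C.mainardiSine q p.1 p.2 := by
  rw [continuous_iff_continuousAt]
  intro p₀
  rw [ContinuousAt, tendsto_iff_norm_sub_tendsto_zero]
  set c := K / Real.Gamma (2 * q)
  have hlim : Tendsto (fun p : ℝ × X => c * |p.1| * ‖p.2 - p₀.2‖ + c * |p.1 - p₀.1| * ‖p₀.2‖)
      (𝓝 p₀) (𝓝 0) := by
    have : Continuous fun p : ℝ × X =>
        c * |p.1| * ‖p.2 - p₀.2‖ + c * |p.1 - p₀.1| * ‖p₀.2‖ := by fun_prop
    simpa using this.tendsto p₀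
  refine squeeze_zero (fun _ => norm_nonneg _) (fun p => ?_) hlim
  have e : C.mainardiSine q p.1 p.2 - C.mainardiSine q p₀.1 p₀.2 = C.mainardiSine q p.1 (p.2 - p₀.2)
      + (C.mainardiSine q p.1 p₀.2 - C.mainardiSine q p₀.1 p₀.2) := by
    rw [mainardiSine_sub hq0 hq1 hC]
    abel
  rw [e]
  exact (norm_add_le _ _).trans (add_le_add (norm_mainardiSine_le hq0 hq1 hC _ _)
    (norm_mainardiSine_sub_le hq0 hq1 hC _ _ _))

/-- The operator `u^(q-1) P` occurring in the source term of the equation of mild solutions, where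
`P = P_q^ψ(t,s)` and `u = ψ(t) - ψ(s)`. -/
def sourceKernel (C : CosineFamily X) (q u : ℝ) (x : X) : X :=
  u ^ (q - 1) • C.mainardiSine q (u ^ q) x

lemma norm_sourceKernel_sub_le (hq : 1 / 2 < q) (hq1 : q ≤ 1) (hC : ∀ t, ‖C.op t‖ ≤ K) {u : ℝ}
    (hu : 0 ≤ u) (x y : X) : ‖C.sourceKernel q u x - C.sourceKernel q u y‖
      ≤ K / Real.Gamma (2 * q) * u ^ (2 * q - 1) * ‖x - y‖ := by
  have hq0 : 0 < q := by linarith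
  have e : u ^ (q - 1) * u ^ q = u ^ (2 * q - 1) := by
    rcases hu.eq_or_lt with rfl | hu
    · rw [Real.zero_rpow hq0.ne', mul_zero, Real.zero_rpow (by linarith)]
    · rw [← Real.rpow_add hu]
      ring_nf
  rw [sourceKernel, sourceKernel, ← smul_sub, ← mainardiSine_sub hq0 hq1 hC, norm_smul,
    Real.norm_of_nonneg (by positivity), ← e]
  calc u ^ (q - 1) * ‖C.mainardiSine q (u ^ q) (x - y)‖
      ≤ u ^ (q - 1) * (K / Real.Gamma (2 * q) * |u ^ q| * ‖x - y‖) := by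
        gcongr
        exact norm_mainardiSine_le hq0 hq1 hC _ _
    _ = _ := by
        rw [abs_of_nonneg (by positivity)]
        ring

lemma sourceKernel_zero_right (u : ℝ) : C.sourceKernel q u 0 = 0 := by
  simp [sourceKernel, mainardiSine, sine]

/-- The singularity of `u^(q-1)` at `u = 0` is harmless, since `q > 1/2`. -/
lemma continuous_sourceKernel (hq : 1 / 2 < q) (hq1 : q ≤ 1) (hC : ∀ t, ‖C.op t‖ ≤ K) :
    Continuous fun p : ℝ × X => C.sourceKernel q (max p.1 0) p.2 := by
  have hq0 : 0 < q := by linarith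
  rw [continuous_iff_continuousAt]
  intro p₀
  rcases lt_or_ge 0 p₀.1 with h | h
  · have h1 : ContinuousAt (fun p : ℝ × X => max p.1 0 ^ (q - 1)) p₀ :=
      ContinuousAt.rpow_const (by fun_prop) (Or.inl (by simp [h.le, h.ne']))
    have h2 : Continuous fun p : ℝ × X => (max p.1 0 ^ q, p.2) :=
      ((continuous_fst.max continuous_const).rpow_const fun _ => Or.inr hq0.le).prodMk
        continuous_snd
    exact h1.smul ((continuous_mainardiSine hq0 hq1 hC).comp h2).continuousAt
  · have h0 : C.sourceKernel q (max p₀.1 0) p₀.2 = 0 := by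
      rw [max_eq_right h, sourceKernel, Real.zero_rpow hq0.ne', mainardiSine_zero_left, smul_zero]
    have hcont : Continuous fun p : ℝ × X =>
        K / Real.Gamma (2 * q) * max p.1 0 ^ (2 * q - 1) * ‖p.2‖ :=
      (continuous_const.mul ((continuous_fst.max continuous_const).rpow_const
        fun _ => Or.inr (by linarith))).mul continuous_snd.norm
    have hlim := hcont.tendsto p₀
    rw [max_eq_right h, Real.zero_rpow (by linarith), mul_zero, zero_mul] at hlim
    rw [ContinuousAt, h0]
    refine squeeze_zero_norm (fun p => ?_) hlim
    simpa [sourceKernel_zero_right] using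
      norm_sourceKernel_sub_le hq hq1 hC (le_max_right p.1 0) p.2 0

end CosineFamily

end SourceKernel

/-! ### Fixed points of Volterra operators -/

section Volterra

variable {X : Type*} [NormedAddCommGroup X] {T : ℝ}

/-- The iterates of a Volterra operator with bounded kernel have Lipschitz constants
`(L T)ⁿ / n!`, so that some iterate is a contraction. -/
lemma existsUnique_fixedPoint_of_volterra [CompleteSpace X] (hT : 0 < T)
    {F : C(Icc (0 : ℝ) T, X) → C(Icc (0 : ℝ) T, X)} {s : Set C(Icc (0 : ℝ) T, X)}
    (hs : IsClosed s) (hne : s.Nonempty) (hmaps : MapsTo F s s) {L : ℝ} (hL : 0 ≤ L)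
    (hF : ∀ x ∈ s, ∀ y ∈ s, ∀ t : Icc (0 : ℝ) T, ‖F x t - F y t‖
      ≤ L * ∫ r in (0 : ℝ)..t, ‖IccExtend hT.le x r - IccExtend hT.le y r‖) :
    ∃! x, x ∈ s ∧ F x = x := by
  have iter : ∀ n : ℕ, ∀ x ∈ s, ∀ y ∈ s, ∀ t : Icc (0 : ℝ) T,
      ‖F^[n] x t - F^[n] y t‖ ≤ (L * t) ^ n / n.factorial * ‖x - y‖ := by
    intro n
    induction n with
    | zero => exact fun x _ y _ t => by simpa using (x - y).norm_coe_le_norm t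
    | succ n ih =>
      intro x hx y hy t
      rw [Function.iterate_succ_apply', Function.iterate_succ_apply']
      refine (hF _ (hmaps.iterate n hx) _ (hmaps.iterate n hy) t).trans ?_
      have hmono : ∫ r in (0 : ℝ)..t, ‖IccExtend hT.le (F^[n] x) r - IccExtend hT.le (F^[n] y) r‖
          ≤ ∫ r in (0 : ℝ)..t, (L * r) ^ n / n.factorial * ‖x - y‖ := by
        refine intervalIntegral.integral_mono_on t.2.1 ?_ ?_ fun r hr => ?_
        · exact (((F^[n] x).continuous.Icc_extend' (h := hT.le)).sub
            ((F^[n] y).continuous.Icc_extend' (h := hT.le))).norm.intervalIntegrable _ _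
        · exact Continuous.intervalIntegrable (by fun_prop) _ _
        · have hr' : r ∈ Icc (0 : ℝ) T := ⟨hr.1, hr.2.trans t.2.2⟩
          rw [IccExtend_of_mem _ _ hr', IccExtend_of_mem _ _ hr']
          exact ih x hx y hy ⟨r, hr'⟩
      calc L * ∫ r in (0 : ℝ)..t, ‖IccExtend hT.le (F^[n] x) r - IccExtend hT.le (F^[n] y) r‖
          ≤ L * ∫ r in (0 : ℝ)..t, (L * r) ^ n / n.factorial * ‖x - y‖ := by gcongr
        _ = (L * t) ^ (n + 1) / (n + 1).factorial * ‖x - y‖ := by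
            simp only [mul_pow, intervalIntegral.integral_mul_const,
              intervalIntegral.integral_div, intervalIntegral.integral_const_mul, integral_pow,
              Nat.factorial_succ]
            push_cast
            rw [zero_pow n.succ_ne_zero]
            field_simp
            ring
  have hdist : ∀ n : ℕ, ∀ x ∈ s, ∀ y ∈ s,
      dist (F^[n] x) (F^[n] y) ≤ (L * T) ^ n / n.factorial * dist x y := by
    intro n x hx y hy
    rw [ContinuousMap.dist_le (by positivity)]
    intro t
    rw [dist_eq_norm, dist_eq_norm]
    refine (iter n x hx y hy t).trans ?_
    have h0 := t.2.1
    have h1 := t.2.2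
    gcongr
  obtain ⟨n, hn⟩ := ((FloorSemiring.tendsto_pow_div_factorial_atTop (L * T)).eventually_lt_const
    (by norm_num : (0 : ℝ) < 1)).exists
  have hn0 : 0 ≤ (L * T) ^ n / n.factorial := by positivity
  have : CompleteSpace s := hs.completeSpace_coe
  have : Nonempty s := hne.to_subtype
  have hcontr : ContractingWith ⟨(L * T) ^ n / n.factorial, hn0⟩ (hmaps.restrict F s s)^[n] := by
    refine ⟨by exact_mod_cast hn, LipschitzWith.of_dist_le_mul fun x y => ?_⟩
    rw [hmaps.iterate_restrict n]
    exact hdist n x x.2 y y.2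
  have hfix := hcontr.isFixedPt_fixedPoint_iterate
  set x₀ := hcontr.fixedPoint (hmaps.restrict F s s)^[n]
  refine ⟨x₀, ⟨x₀.2, congrArg Subtype.val hfix⟩, fun y hy => ?_⟩
  have hyfix : Function.IsFixedPt (hmaps.restrict F s s) ⟨y, hy.1⟩ := Subtype.ext hy.2
  exact congrArg Subtype.val (hcontr.fixedPoint_unique (hyfix.iterate n))

/-- For large `β`, the essential supremum of `h_β` is at most `H' β` if `H < H'`, and `h_β` bounds
`f` along every function in the ball of radius `β`. -/
lemma HasGrowthBound.eventually_norm_le (hT : 0 < T) {f : Icc (0 : ℝ) T → X → X} {H H' : ℝ}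
    (hf : HasGrowthBound f H) (hH : 0 < H) (hH' : H < H') :
    ∀ᶠ β in atTop, ∀ y : C(Icc (0 : ℝ) T, X), ‖y‖ ≤ β →
      ∀ᵐ r ∂volume.restrict (Icc (0 : ℝ) T),
        ‖IccExtend hT.le (fun r => f r (y r)) r‖ ≤ H' * β := by
  obtain ⟨h, hbound, hlim⟩ := hf
  have hlt : limsup (fun β : ℝ => eLpNorm (h β) ∞ (volume.restrict (Icc (0 : ℝ) T)) /
      ENNReal.ofReal β) atTop < ENNReal.ofReal H' := by
    rw [hlim]
    exact (ENNReal.ofReal_lt_ofReal_iff (hH.trans hH')).2 hH'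
  filter_upwards [eventually_lt_of_limsup_lt hlt, eventually_gt_atTop 0] with β hβ hβ0 y hy
  have hsup : eLpNorm (h β) ∞ (volume.restrict (Icc (0 : ℝ) T)) ≤ ENNReal.ofReal (H' * β) := by
    rw [ENNReal.ofReal_mul (hH.trans hH').le]
    exact (ENNReal.div_le_iff_le_mul (Or.inl (by simpa using hβ0))
      (Or.inl ENNReal.ofReal_ne_top)).1 hβ.le
  rw [eLpNorm_exponent_top] at hsup
  filter_upwards [ae_le_eLpNormEssSup (f := h β) (μ := volume.restrict (Icc (0 : ℝ) T)),
    ae_restrict_mem measurableSet_Icc] with r hr hrT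
  rw [IccExtend_of_mem _ _ hrT]
  have h1 : ENNReal.ofReal ‖h β r‖ ≤ ENNReal.ofReal (H' * β) := by
    rw [ofReal_norm]
    exact hr.trans hsup
  calc ‖f ⟨r, hrT⟩ (y ⟨r, hrT⟩)‖ ≤ h β r := (hbound β hβ0).2 y hy ⟨r, hrT⟩
    _ ≤ ‖h β r‖ := le_abs_self _
    _ ≤ H' * β := (ENNReal.ofReal_le_ofReal_iff (mul_pos (hH.trans hH') hβ0).le).1 h1

/-- A nonlinear Volterra equation `Θ(t) = a(t) + ∫₀ᵗ k(t,s) f(s,Θ(s)) ds` has exactly one continuous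
solution, if the kernel is continuous with `∫₀ᵗ ‖k(t,s)‖ ds ≤ Λ`, and if `f` is Lipschitz on balls
and of linear growth with a rate `H < 1 / Λ`. The growth condition confines the fixed points to
every large ball, and on each ball some iterate of the integral operator is a contraction. -/
theorem existsUnique_volterra [NormedSpace ℝ X] [CompleteSpace X] (hT : 0 < T)
    (a : C(Icc (0 : ℝ) T, X)) {k : ℝ → ℝ → X → X} {κ : ℝ → ℝ → ℝ}
    (hk : Continuous fun p : ℝ × ℝ × X => k p.1 p.2.1 p.2.2)
    (hκ : Continuous fun p : ℝ × ℝ => κ p.1 p.2) (hκ0 : ∀ t s, 0 ≤ κ t s)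
    (hk_zero : ∀ t s, k t s 0 = 0)
    (hk_sub : ∀ t s x y, ‖k t s x - k t s y‖ ≤ κ t s * ‖x - y‖)
    {Λ : ℝ} (hΛ0 : 0 < Λ) (hΛ : ∀ t ∈ Icc (0 : ℝ) T, ∫ s in (0 : ℝ)..t, κ t s ≤ Λ)
    {f : Icc (0 : ℝ) T → X → X} (hf_lip : LocallyLipschitzOnBalls f)
    {H : ℝ} (hH : 0 < H) (hf_growth : HasGrowthBound f H) (hsmall : H * Λ < 1) :
    ∃! Θ : C(Icc (0 : ℝ) T, X), ∀ t : Icc (0 : ℝ) T,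
      Θ t = a t + ∫ s in (0 : ℝ)..t, k t s (IccExtend hT.le (fun r => f r (Θ r)) s) := by
  have hg : ∀ Θ : C(Icc (0 : ℝ) T, X), Continuous (IccExtend hT.le fun r => f r (Θ r)) :=
    fun Θ => (hf_lip.1.comp (continuous_id.prodMk Θ.continuous)).Icc_extend'
  have hkc : ∀ Θ : C(Icc (0 : ℝ) T, X), Continuous (Function.uncurry fun t s : ℝ =>
      k t s (IccExtend hT.le (fun r => f r (Θ r)) s)) := fun Θ =>
    hk.comp (continuous_fst.prodMk (continuous_snd.prodMk ((hg Θ).comp continuous_snd)))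
  have hκt : ∀ t, Continuous (κ t) := fun t => hκ.comp (continuous_const.prodMk continuous_id)
  let F : C(Icc (0 : ℝ) T, X) → C(Icc (0 : ℝ) T, X) := fun Θ =>
    ⟨fun t => a t + ∫ s in (0 : ℝ)..t, k t s (IccExtend hT.le (fun r => f r (Θ r)) s),
      a.continuous.add ((intervalIntegral.continuous_parametric_intervalIntegral_of_continuous
        (hkc Θ) continuous_id).comp continuous_subtype_val)⟩
  have hFapply : ∀ (Θ : C(Icc (0 : ℝ) T, X)) (t : Icc (0 : ℝ) T), F Θ t = a t +
      ∫ s in (0 : ℝ)..t, k t s (IccExtend hT.le (fun r => f r (Θ r)) s) := fun _ _ => rfl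
  have hfix : ∀ Θ, F Θ = Θ ↔ ∀ t : Icc (0 : ℝ) T,
      Θ t = a t + ∫ s in (0 : ℝ)..t, k t s (IccExtend hT.le (fun r => f r (Θ r)) s) := fun Θ =>
    ⟨fun h t => by rw [← hFapply, h], fun h => ContinuousMap.ext fun t => by rw [hFapply, ← h]⟩
  simp only [← hfix]
  -- every large ball is invariant
  obtain ⟨H', hHH', hH'⟩ := exists_between ((lt_div_iff₀ hΛ0).2 hsmall)
  rw [lt_div_iff₀ hΛ0] at hH'
  have hinv : ∀ᶠ β in atTop, MapsTo F (Metric.closedBall 0 β) (Metric.closedBall 0 β) := by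
    filter_upwards [hf_growth.eventually_norm_le hT hH hHH',
      eventually_ge_atTop (‖a‖ / (1 - H' * Λ)), eventually_gt_atTop 0] with β hβ hβa hβ0 Θ hΘ
    rw [div_le_iff₀ (by linarith)] at hβa
    rw [mem_closedBall_zero_iff] at hΘ ⊢
    rw [ContinuousMap.norm_le _ hβ0.le]
    intro t
    have hint : ‖∫ s in (0 : ℝ)..t, k t s (IccExtend hT.le (fun r => f r (Θ r)) s)‖
        ≤ ∫ s in (0 : ℝ)..t, κ t s * (H' * β) := by
      refine intervalIntegral.norm_integral_le_of_norm_le t.2.1 ?_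
        (((hκt t).mul continuous_const).intervalIntegrable _ _)
      have h1 := (ae_restrict_iff' measurableSet_Icc).1 (hβ Θ hΘ)
      filter_upwards [h1] with s hs hst
      have h2 := hk_sub t s (IccExtend hT.le (fun r => f r (Θ r)) s) 0
      rw [hk_zero, sub_zero, sub_zero] at h2
      refine h2.trans (mul_le_mul_of_nonneg_left ?_ (hκ0 _ _))
      exact hs ⟨hst.1.le, hst.2.trans t.2.2⟩
    rw [intervalIntegral.integral_mul_const] at hint
    have hHβ : 0 ≤ H' * β := (mul_pos (hH.trans hHH') hβ0).le
    calc ‖F Θ t‖ ≤ ‖a t‖ + ‖∫ s in (0 : ℝ)..t, k t s (IccExtend hT.le (fun r => f r (Θ r)) s)‖ :=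
          norm_add_le _ _
      _ ≤ ‖a‖ + Λ * (H' * β) := add_le_add (a.norm_coe_le_norm t)
          (hint.trans (mul_le_mul_of_nonneg_right (hΛ t t.2) hHβ))
      _ ≤ β := by linarith
  -- the kernel is bounded, so that the operator is of Volterra type with a bounded kernel
  obtain ⟨M, hM⟩ := (isCompact_Icc.prod isCompact_Icc :
    IsCompact (Icc (0 : ℝ) T ×ˢ Icc (0 : ℝ) T)).exists_bound_of_continuousOn hκ.continuousOn
  have hM0 : 0 ≤ M := (norm_nonneg _).trans (hM (0, 0) ⟨⟨le_rfl, hT.le⟩, ⟨le_rfl, hT.le⟩⟩)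
  have hunique : ∀ β : ℝ, 0 < β → MapsTo F (Metric.closedBall 0 β) (Metric.closedBall 0 β) →
      ∃! Θ, Θ ∈ Metric.closedBall (0 : C(Icc (0 : ℝ) T, X)) β ∧ F Θ = Θ := by
    intro β hβ0 hβ
    obtain ⟨N, hN0, hN⟩ := hf_lip.2 β hβ0
    refine existsUnique_fixedPoint_of_volterra hT Metric.isClosed_closedBall
      (Metric.nonempty_closedBall.2 hβ0.le) hβ (mul_nonneg hM0 hN0.le) fun x hx y hy t => ?_
    rw [mem_closedBall_zero_iff] at hx hy
    have hkt : ∀ Θ : C(Icc (0 : ℝ) T, X), IntervalIntegrable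
        (fun s => k t s (IccExtend hT.le (fun r => f r (Θ r)) s)) volume 0 t := fun Θ =>
      ((hkc Θ).comp (continuous_const.prodMk continuous_id)).intervalIntegrable _ _
    rw [hFapply, hFapply, add_sub_add_left_eq_sub, ← intervalIntegral.integral_sub (hkt x) (hkt y),
      ← intervalIntegral.integral_const_mul]
    refine intervalIntegral.norm_integral_le_of_norm_le t.2.1
      (Eventually.of_forall fun s hs => ?_) ?_
    · have hs' : s ∈ Icc (0 : ℝ) T := ⟨hs.1.le, hs.2.trans t.2.2⟩
      refine (hk_sub _ _ _ _).trans ?_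
      simp only [IccExtend_of_mem hT.le _ hs']
      rw [mul_assoc]
      exact mul_le_mul ((le_abs_self _).trans (hM (t, s) ⟨t.2, hs'⟩)) (hN x y hx hy ⟨s, hs'⟩)
        (norm_nonneg _) hM0
    · exact (continuous_const.mul ((x.continuous.Icc_extend' (h := hT.le)).sub
        (y.continuous.Icc_extend' (h := hT.le))).norm).intervalIntegrable _ _
  obtain ⟨β, hβ, hβ0⟩ := (hinv.and (eventually_gt_atTop 0)).exists
  obtain ⟨Θ, ⟨-, hΘ⟩, -⟩ := hunique β hβ0 hβ
  refine ⟨Θ, hΘ, fun Θ' hΘ' => ?_⟩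
  -- two fixed points lie in a common invariant ball
  obtain ⟨γ, hγ, hγ0, h1, h2⟩ := (hinv.and ((eventually_gt_atTop 0).and
    ((eventually_ge_atTop ‖Θ‖).and (eventually_ge_atTop ‖Θ'‖)))).exists
  exact (hunique γ hγ0 hγ).unique ⟨mem_closedBall_zero_iff.2 h2, hΘ'⟩
    ⟨mem_closedBall_zero_iff.2 h1, hΘ⟩

end Volterra

end

/-! ### Mild solutions -/

lemma continuousOn_cosineResolvent {X : Type*} [NormedAddCommGroup X] [NormedSpace ℝ X]
    [CompleteSpace X] {C : CosineFamily X} {ψ : ℝ → ℝ} {q K : ℝ} {s : Set ℝ}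
    (hq0 : 0 < q) (hq1 : q ≤ 1) (hC : ∀ t, ‖C.op t‖ ≤ K) (hψ : ContinuousOn ψ s) (x : X) :
    ContinuousOn (fun t => cosineResolvent C ψ q t x) s := by
  have := isFiniteMeasure_mainardiMeasure hq0 hq1
  simp only [cosineResolvent, mainardiIntegral_eq_integral hq0 hq1]
  have hC' := C.strongly_continuous x
  refine continuousOn_of_dominated (bound := fun _ => K * ‖x‖) (fun t _ => ?_) (fun t _ => ?_)
    (integrable_const _) (Eventually.of_forall fun θ => ?_)
  · exact Continuous.aestronglyMeasurable (by fun_prop)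
  · exact Eventually.of_forall fun θ => (C.op _).le_of_opNorm_le (hC _) x
  · exact hC'.comp_continuousOn (((hψ.sub continuousOn_const).rpow_const
      fun _ _ => Or.inr hq0.le).mul continuousOn_const)

lemma continuousOn_sineResolvent {X : Type*} [NormedAddCommGroup X] [NormedSpace ℝ X]
    [CompleteSpace X] {C : CosineFamily X} {ψ : ℝ → ℝ} {q K T : ℝ} (hT : 0 < T)
    (hq0 : 0 < q) (hq1 : q ≤ 1) (hC : ∀ t, ‖C.op t‖ ≤ K) (hψ : ContDiffOn ℝ 1 ψ (Icc 0 T))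
    (x : X) : ContinuousOn (fun t => sineResolvent C T ψ q t x) (Icc 0 T) := by
  have h : ContinuousOn (fun s => (derivWithin ψ (Icc 0 T) s / derivWithin ψ (Icc 0 T) 0) •
      cosineResolvent C ψ q s x) (uIcc 0 T) := by
    rw [uIcc_of_le hT.le]
    exact ((hψ.continuousOn_derivWithin (uniqueDiffOn_Icc hT) le_rfl).div_const _).smul
      (continuousOn_cosineResolvent hq0 hq1 hC hψ.continuousOn x)
  have h' := intervalIntegral.continuousOn_primitive_interval (μ := volume)
    (h.integrableOn_compact isCompact_uIcc)
  rwa [uIcc_of_le hT.le] at h'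

/-- The total weight of the kernel `(ψ(t) - ψ(s))^(2q-1) ψ'(s)`. -/
lemma integral_rpow_sub_mul_derivWithin {ψ : ℝ → ℝ} {T p : ℝ} (hT : 0 < T) (hp : 0 ≤ p)
    (hψ : ContDiffOn ℝ 1 ψ (Icc 0 T)) {t : ℝ} (ht : t ∈ Icc 0 T) :
    ∫ s in (0 : ℝ)..t, derivWithin ψ (Icc 0 T) s * (ψ t - ψ s) ^ p
      = (ψ t - ψ 0) ^ (p + 1) / (p + 1) := by
  have hp1 : p + 1 ≠ 0 := by positivity
  have hsub : Icc 0 t ⊆ Icc 0 T := Icc_subset_Icc_right ht.2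
  have hψt : ContinuousOn (fun s => ψ t - ψ s) (Icc 0 t) :=
    continuousOn_const.sub (hψ.continuousOn.mono hsub)
  have h := intervalIntegral.integral_eq_sub_of_hasDerivAt_of_le ht.1
    (f := fun s => -((ψ t - ψ s) ^ (p + 1) / (p + 1)))
    (f' := fun s => derivWithin ψ (Icc 0 T) s * (ψ t - ψ s) ^ p)
    ((hψt.rpow_const fun _ _ => Or.inr (by linarith)).div_const _).neg (fun s hs => ?_) ?_
  · rw [h, sub_self, Real.zero_rpow hp1]
    ring
  · have hmem : Icc 0 T ∈ 𝓝 s := Icc_mem_nhds hs.1 (hs.2.trans_le ht.2)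
    have hd : HasDerivAt ψ (derivWithin ψ (Icc 0 T) s) s :=
      ((hψ.differentiableOn one_ne_zero s (mem_of_mem_nhds hmem)).hasDerivWithinAt).hasDerivAt hmem
    have h1 := (((hd.const_sub (ψ t)).rpow_const (p := p + 1)
      (Or.inr (by linarith))).div_const (p + 1)).neg
    rw [add_sub_cancel_right] at h1
    refine h1.congr_deriv ?_
    field_simp
  · refine ContinuousOn.intervalIntegrable_of_Icc ht.1 ?_
    exact ((hψ.continuousOn_derivWithin (uniqueDiffOn_Icc hT) le_rfl).mono hsub).mul
      (hψt.rpow_const fun _ _ => Or.inr hp)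

theorem theorem4p2 {X : Type*} [NormedAddCommGroup X] [NormedSpace ℝ X] [CompleteSpace X]
    (T : ℝ) (hT : 0 < T)
    (α q : ℝ) (hα : α ∈ Ioc (1 : ℝ) 2) (hq : q = α / 2)
    (ψ : ℝ → ℝ) (hψ_mono : StrictMonoOn ψ (Icc 0 T)) (hψ_smooth : ContDiffOn ℝ 1 ψ (Icc 0 T))
    (hψ_deriv : ∀ t ∈ Icc (0 : ℝ) T, derivWithin ψ (Icc 0 T) t ≠ 0)
    (A : X →ₗ.[ℝ] X) (C : CosineFamily X) (hA : A = C.generator)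
    (K : ℝ) (hK : 1 ≤ K) (hC_bdd : ∀ t : ℝ, ‖C.op t‖ ≤ K)
    (f : Icc (0 : ℝ) T → X → X) (Θ₀ Θ₁ : X)
    (hf_lip : LocallyLipschitzOnBalls f)
    (hS_compact : ∀ t : ℝ, 0 < t → IsCompactOperator (C.sine t))
    (H : ℝ) (hH : 0 < H) (hf_growth : HasGrowthBound f H)
    (hsmall : H * K * (ψ T - ψ 0) ^ (2 * q) / Real.Gamma (2 * q + 1) < 1) :
    ∃! Θ : C(Icc (0 : ℝ) T, X), IsMildSolution C hT ψ q f Θ₀ Θ₁ Θ := by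
  have hq2 : 1 / 2 < q := by rw [hq]; linarith [hα.1]
  have hq1 : q ≤ 1 := by rw [hq]; linarith [hα.2]
  have hq0 : 0 < q := by linarith
  have hΓ : 0 < Real.Gamma (2 * q) := Real.Gamma_pos_of_pos (by linarith)
  have h0 : (0 : ℝ) ∈ Icc 0 T := ⟨le_rfl, hT.le⟩
  have hTT : T ∈ Icc 0 T := ⟨hT.le, le_rfl⟩
  let a : C(Icc (0 : ℝ) T, X) :=
    ⟨fun t => cosineResolvent C ψ q t Θ₀ + sineResolvent C T ψ q t Θ₁,
      continuousOn_iff_continuous_domRestrict.1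
        ((continuousOn_cosineResolvent hq0 hq1 hC_bdd hψ_smooth.continuousOn Θ₀).add
          (continuousOn_sineResolvent hT hq0 hq1 hC_bdd hψ_smooth Θ₁))⟩
  -- continuous extensions of `ψ` and `ψ'` to the real line
  set ψe : ℝ → ℝ := IccExtend hT.le ((Icc 0 T).domRestrict ψ)
  set w : ℝ → ℝ := IccExtend hT.le ((Icc 0 T).domRestrict (derivWithin ψ (Icc 0 T)))
  have hψe : Continuous ψe :=
    (continuousOn_iff_continuous_domRestrict.1 hψ_smooth.continuousOn).Icc_extend'
  have hw : Continuous w := (continuousOn_iff_continuous_domRestrict.1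
    (hψ_smooth.continuousOn_derivWithin (uniqueDiffOn_Icc hT) le_rfl)).Icc_extend'
  have hw0 : ∀ s, 0 ≤ w s := fun s => hψ_mono.monotoneOn.derivWithin_nonneg
  have hψe_eq : ∀ s ∈ Icc 0 T, ψe s = ψ s := fun s hs => IccExtend_of_mem _ _ hs
  have hw_eq : ∀ s ∈ Icc 0 T, w s = derivWithin ψ (Icc 0 T) s := fun s hs => IccExtend_of_mem _ _ hs
  have hmax : ∀ t ∈ Icc 0 T, ∀ s ∈ Icc 0 t, max (ψe t - ψe s) 0 = ψ t - ψ s := by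
    intro t ht s hs
    have hsT : s ∈ Icc 0 T := ⟨hs.1, hs.2.trans ht.2⟩
    rw [hψe_eq t ht, hψe_eq s hsT]
    exact max_eq_left (sub_nonneg.2 (hψ_mono.monotoneOn hsT ht hs.2))
  set c := K / Real.Gamma (2 * q)
  have hc0 : 0 < c := by positivity
  set Λ := K * (ψ T - ψ 0) ^ (2 * q) / Real.Gamma (2 * q + 1)
  have hΛ_eq : ∀ x : ℝ, c * (x ^ (2 * q) / (2 * q)) = K * x ^ (2 * q) / Real.Gamma (2 * q + 1) := by
    intro x
    rw [Real.Gamma_add_one (by positivity)]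
    simp only [c]
    field_simp
  have hψT : 0 < ψ T - ψ 0 := sub_pos.2 (hψ_mono h0 hTT hT)
  have key := existsUnique_volterra hT a
    (k := fun t s x => w s • C.sourceKernel q (max (ψe t - ψe s) 0) x)
    (κ := fun t s => c * (w s * max (ψe t - ψe s) 0 ^ (2 * q - 1)))
    ?_ ?_ ?_ ?_ ?_ (Λ := Λ) ?_ ?_ hf_lip hH hf_growth ?_
  · refine (existsUnique_congr fun Θ => forall_congr' fun t => ?_).1 key
    have e : ∫ s in (0 : ℝ)..t, w s • C.sourceKernel q (max (ψe t - ψe s) 0)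
          (IccExtend hT.le (fun r => f r (Θ r)) s)
        = ∫ s in (0 : ℝ)..t, ((ψ t - ψ s) ^ (q - 1) * derivWithin ψ (Icc 0 T) s) •
          sourceResolvent C ψ q t s (IccExtend hT.le (fun r => f r (Θ r)) s) := by
      refine intervalIntegral.integral_congr fun s hs => ?_
      rw [uIcc_of_le t.2.1] at hs
      rw [hmax t t.2 s hs, hw_eq s ⟨hs.1, hs.2.trans t.2.2⟩, CosineFamily.sourceKernel, smul_smul,
        mul_comm, sourceResolvent, mainardiIntegral_eq_integral hq0 hq1, CosineFamily.mainardiSine]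
    rw [e]
    rfl
  · exact (hw.comp (continuous_fst.comp continuous_snd)).smul
      ((CosineFamily.continuous_sourceKernel hq2 hq1 hC_bdd).comp
        (((hψe.comp continuous_fst).sub (hψe.comp (continuous_fst.comp continuous_snd))).prodMk
          (continuous_snd.comp continuous_snd)))
  · exact continuous_const.mul ((hw.comp continuous_snd).mul
      ((((hψe.comp continuous_fst).sub (hψe.comp continuous_snd)).max continuous_const).rpow_const
        fun _ => Or.inr (by linarith)))
  · intro t s
    have := hw0 s
    positivity
  · intro t s
    simp only [CosineFamily.sourceKernel_zero_right, smul_zero]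
  · intro t s x y
    have h := CosineFamily.norm_sourceKernel_sub_le hq2 hq1 hC_bdd
      (le_max_right (ψe t - ψe s) 0) x y
    rw [← smul_sub, norm_smul, Real.norm_of_nonneg (hw0 s)]
    refine (mul_le_mul_of_nonneg_left h (hw0 s)).trans (le_of_eq ?_)
    ring
  · positivity
  · intro t ht
    have e : ∫ s in (0 : ℝ)..t, c * (w s * max (ψe t - ψe s) 0 ^ (2 * q - 1))
        = K * (ψ t - ψ 0) ^ (2 * q) / Real.Gamma (2 * q + 1) := by
      have h := integral_rpow_sub_mul_derivWithin hT (by linarith : 0 ≤ 2 * q - 1) hψ_smooth ht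
      rw [sub_add_cancel] at h
      rw [intervalIntegral.integral_const_mul, ← hΛ_eq, ← h]
      congr 1
      refine intervalIntegral.integral_congr fun s hs => ?_
      rw [uIcc_of_le ht.1] at hs
      rw [hmax t ht s hs, hw_eq s ⟨hs.1, hs.2.trans ht.2⟩]
    rw [e]
    have h1 : 0 ≤ ψ t - ψ 0 := sub_nonneg.2 (hψ_mono.monotoneOn h0 ht ht.1)
    have h2 : ψ t ≤ ψ T := hψ_mono.monotoneOn ht hTT ht.2
    have h3 : 0 < Real.Gamma (2 * q + 1) := Real.Gamma_pos_of_pos (by linarith)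
    simp only [Λ]
    gcongr
  · refine lt_of_eq_of_lt ?_ hsmall
    ring
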